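/- A Markov decision process (MDP) $\mathcal M=(S,S_\Box,S_\bigcirc,\to,P)$ consists of a countable set $S$ of states, partitioned into player states $S_\Box$ and random states $S_\bigcirc$, a transition relation $\to\;\subseteq S\times S$ such that every state has a successor, and a probability distribution $P(s)$ over the successors of $s$ for each random state $s\in S_\bigcirc$. It is finitely branching if every state has only finitely many successors. A strategy $\sigma$ assigns to each finite sequence of states $ws\in S^*S_\Box$ ending in a player state $s$ a probability distribution over the successors of $s$; it is memoryless deterministic (MD) if this is always a Dirac distribution that depends only on $s$. A strategy $\sigma$ and an initial state $s$ induce in the usual way a probability measure $\mathcal P_{\mathcal M,s,\sigma}$ on infinite sequences of states starting in $s$. For an objective (a measurable set of infinite sequences) $\varphi$, the value of $s$ is $\mathrm{val}_{\mathcal M}(s)=\sup_\sigma \mathcal P_{\mathcal M,s,\sigma}(\varphi)$, the supremum being over all strategies, and $\sigma$ is optimal from $s$ if $\mathcal P_{\mathcal M,s,\sigma}(\varphi)=\mathrm{val}_{\mathcal M}(s)$. **Theorem.** Let $\mathcal M$ be a countable, finitely branching MDP, let $\mathit{Col}:S\to\{0,1,2\}$ be a colour function, and let $\varphi$ be the parity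 objective: the set of infinite sequences of states in which the largest colour that occurs infinitely often is even. Then there is an MD strategy $\hat\sigma$ that is optimal from every state from which some strategy is optimal: for every $s\in S$, if there is a strategy $\sigma$ with $\mathcal P_{\mathcal M,s,\sigma}(\varphi)=\mathrm{val}_{\mathcal M}(s)$, then $\mathcal P_{\mathcal M,s,\hat\sigma}(\varphi)=\mathrm{val}_{\mathcal M}(s)$. -/

import Mathlib

open MeasureTheory ProbabilityTheory Filter
open scoped ENNReal

/-- A Markov decision process with state space `S`. The set `player` holds the states of the player,
its complement the random states. Every state has a successor, and a random state `s` comes with a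
probability distribution `prob s` over its successors. -/
structure MDP (S : Type*) where
  player : Set S
  step : S → S → Prop
  exists_step : ∀ s, ∃ t, step s t
  prob : {s : S // s ∉ player} → PMF S
  step_of_mem_support : ∀ s, ∀ t ∈ (prob s).support, step s t

namespace MDP

variable {S : Type*}

/-- Each state has only finitely many successors. -/
def FinitelyBranching (M : MDP S) : Prop :=
  ∀ s, {t | M.step s t}.Finite

/-- A (history-dependent, randomized) strategy. Given a finite sequence `w s` of states that ends in
a player state `s`, it chooses a distribution `choice w s` over the successors of `s`. -/
structure Strategy (M : MDP S) where
  choice : List S → {s : S // s ∈ M.player} → PMF S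
  step_of_mem_support : ∀ w s, ∀ t ∈ (choice w s).support, M.step s t

namespace Strategy

variable {M : MDP S}

/-- A memoryless deterministic (MD) strategy: the choice is a Dirac distribution that depends only
on the current state. -/
def IsMD (σ : M.Strategy) : Prop :=
  ∃ f : {s : S // s ∈ M.player} → S, ∀ w s, σ.choice w s = PMF.pure (f s)

open Classical in
/-- The distribution of the next state after the finite sequence `w s`: the one chosen by the strategy
if `s` is a player state, the one given by the MDP if `s` is a random state. -/
noncomputable def next (σ : M.Strategy) (w : List S) (s : S) : PMF S :=
  if h : s ∈ M.player then σ.choice w ⟨s, h⟩ else M.prob ⟨s, h⟩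

variable [Countable S] [MeasurableSpace S] [DiscreteMeasurableSpace S]

/-- The transition kernel from the states `h 0, …, h n` visited so far to the state at time `n + 1`. -/
noncomputable def kernel (σ : M.Strategy) (n : ℕ) : Kernel (Finset.Iic n → S) S :=
  Kernel.ofFunOfCountable fun h =>
    (σ.next (List.ofFn fun i : Fin n => h ⟨i, Finset.mem_Iic.2 i.2.le⟩)
      (h ⟨n, Finset.mem_Iic.2 le_rfl⟩)).toMeasure

instance (σ : M.Strategy) (n : ℕ) : IsMarkovKernel (σ.kernel n) :=
  ⟨fun _ => PMF.toMeasure.isProbabilityMeasure _⟩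

/-- The probability measure on infinite sequences of states that the strategy `σ` induces from the
initial state `s`. -/
noncomputable def playMeasure (σ : M.Strategy) (s : S) : Measure (ℕ → S) :=
  Kernel.trajMeasure (X := fun _ => S) (Measure.dirac s) σ.kernel

end Strategy

/-- The parity objective of a colour function: the largest colour that occurs infinitely often is
even. -/
def parity (col : S → ℕ) : Set (ℕ → S) :=
  {w | ∃ i : ℕ, (∃ᶠ n in atTop, col (w n) = 2 * i) ∧ ∀ᶠ n in atTop, col (w n) ≤ 2 * i}

variable [Countable S] [MeasurableSpace S] [DiscreteMeasurableSpace S]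

/-- The value of a state: the supremum, over all strategies, of the probability that the objective
`φ` is achieved. -/
noncomputable def value (M : MDP S) (φ : Set (ℕ → S)) (s : S) : ℝ≥0∞ :=
  ⨆ σ : M.Strategy, σ.playMeasure s φ

/-- The strategy `σ` attains the value of the state `s`. -/
def Strategy.IsOptimalFrom {M : MDP S} (σ : M.Strategy) (φ : Set (ℕ → S)) (s : S) : Prop :=
  M.value φ s ≤ σ.playMeasure s φ

end MDP

/-! States of value zero need no care. On the set `optimalStates` of the other states with an
optimal strategy, only value-preserving moves are kept, and each random transition to `t` is
reweighted by the value of `t` divided by the value of its source (a Doob transform,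
`optimalDecisions`). This amounts to conditioning on winning. All other states become absorbing with
colour 0. The task is now to win almost surely everywhere by one memoryless rule; `mul_chain_le`
then undoes the weighting and turns probability one into the value.

What an optimal strategy supplies is `reach_optimalDecisions_eq_one`: if `T` contains colour 2 and
one cannot stay in colour 0 outside `T`, then `T` can be reached with probability arbitrarily close
to one. Indeed a winning play that avoids `T` would eventually stay in colour 0 outside `T`, which
has probability zero.

Let `v` be the best probability of staying in colour 0. In `exists_reach_two_or_stay_zero` the
decisions are frozen to ones preserving `v` wherever `v` is at least 1/2, and a memoryless rule then
reaches almost surely colour 2 or a state with `v` at least 3/4. From the latter the frozen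
decisions keep colour 0 forever with probability at least 1/2. By a zero-one argument
(`chain_parity_eq_one`) a losing play would see colour 2 infinitely often, hence win.

Finite branching enters through compactness: optimal decisions exist for staying, and successive
restrictions of the decision sets have a common selection (`exists_reach_singleton_eq_one`). -/

namespace MDP

/-! ### Path measures, cylinders and the one-step decomposition. -/

variable {S : Type*}

/-- The infinite sequences that agree with `x` up to time `n`. -/
def initialCylinder (x : ℕ → S) (n : ℕ) : Set (ℕ → S) := {w | ∀ i ≤ n, w i = x i}

/-- The sequence that starts with `s` and continues with `w`. -/
def pathCons (s : S) (w : ℕ → S) : ℕ → S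
  | 0 => s
  | n + 1 => w n

@[simp] lemma pathCons_zero (s : S) (w : ℕ → S) : pathCons s w 0 = s := rfl

@[simp] lemma pathCons_succ (s : S) (w : ℕ → S) (n : ℕ) : pathCons s w (n + 1) = w n := rfl

lemma initialCylinder_eq_preimage (x : ℕ → S) (n : ℕ) :
    initialCylinder x n =
      Preorder.frestrictLe (π := fun _ : ℕ => S) n ⁻¹' {Preorder.frestrictLe n x} := by
  ext w
  simp only [initialCylinder, Set.mem_ofPred_eq, Set.mem_preimage, Set.mem_singleton_iff]
  constructor
  · intro h
    ext ⟨i, hi⟩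
    exact h i (Finset.mem_Iic.1 hi)
  · intro h i hi
    exact congrFun h ⟨i, Finset.mem_Iic.2 hi⟩

lemma preimage_pathCons_initialCylinder_succ {x : ℕ → S} {s : S} (hx : x 0 = s) (n : ℕ) :
    pathCons s ⁻¹' initialCylinder x (n + 1) = initialCylinder (fun i => x (i + 1)) n := by
  ext w
  constructor
  · intro h i hi
    exact h (i + 1) (by lia)
  · intro h i hi
    cases i with
    | zero => exact hx.symm
    | succ i => exact h i (by lia)

lemma preimage_pathCons_initialCylinder_of_ne {x : ℕ → S} {s : S} (hx : x 0 ≠ s) (n : ℕ) :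
    pathCons s ⁻¹' initialCylinder x n = ∅ := by
  ext w
  simpa [initialCylinder] using ⟨0, Nat.zero_le _, Ne.symm hx⟩

lemma pathCons_mem_parity {col : S → ℕ} {s : S} {w : ℕ → S} :
    pathCons s w ∈ parity col ↔ w ∈ parity col := by
  have h : ∀ p : S → Prop,
      (∃ᶠ n in atTop, p (pathCons s w n)) ↔ ∃ᶠ n in atTop, p (w n) := by
    intro p
    rw [← map_add_atTop_eq_nat 1, frequently_map]
    simp only [pathCons_succ, map_add_atTop_eq_nat]
  have h' : ∀ p : S → Prop,
      (∀ᶠ n in atTop, p (pathCons s w n)) ↔ ∀ᶠ n in atTop, p (w n) := by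
    intro p
    rw [← map_add_atTop_eq_nat 1, eventually_map]
    simp only [pathCons_succ, map_add_atTop_eq_nat]
  exact exists_congr fun i => and_congr (h fun t => col t = 2 * i) (h' fun t => col t ≤ 2 * i)

variable [MeasurableSpace S]

lemma measurable_pathCons (s : S) : Measurable (pathCons s) := by
  refine measurable_pi_lambda _ fun n => ?_
  cases n with
  | zero => exact measurable_const
  | succ n => exact measurable_pi_apply n

variable [DiscreteMeasurableSpace S]

lemma measurableSet_parity (col : S → ℕ) : MeasurableSet (parity col) := by
  have hm : ∀ (p : S → Prop) (n : ℕ), MeasurableSet {w : ℕ → S | p (w n)} := fun p n =>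
    measurable_pi_apply n (.of_discrete (s := {t | p t}))
  simp only [parity, frequently_atTop, eventually_atTop]
  refine measurableSet_setOfPred.2 (Measurable.exists fun i => Measurable.and ?_ ?_)
  · exact Measurable.forall fun a => Measurable.exists fun b =>
      Measurable.and measurable_const (measurableSet_setOfPred.1 (hm (fun t => col t = 2 * i) b))
  · exact Measurable.exists fun a => Measurable.forall fun b =>
      Measurable.imp measurable_const (measurableSet_setOfPred.1 (hm (fun t => col t ≤ 2 * i) b))

variable [Countable S]

lemma measurableSet_initialCylinder (x : ℕ → S) (n : ℕ) : MeasurableSet (initialCylinder x n) := by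
  rw [initialCylinder_eq_preimage]
  exact Preorder.measurable_frestrictLe n (measurableSet_singleton _)

/-- An inequality between finite measures on sequences can be checked on cylinders. -/
lemma measure_le_of_initialCylinder {μ ν : Measure (ℕ → S)} [IsFiniteMeasure μ]
    [IsFiniteMeasure ν] (h : ∀ x n, ν (initialCylinder x n) ≤ μ (initialCylinder x n)) :
    ν ≤ μ := by
  -- With the discrete topology on `S`, finite measures on the product are outer regular, so open
  -- sets suffice.
  let _ : TopologicalSpace S := ⊥
  have : DiscreteTopology S := ⟨rfl⟩
  have key : ∀ n (B : Set (Finset.Iic n → S)),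
      ν (Preorder.frestrictLe (π := fun _ : ℕ => S) n ⁻¹' B) ≤
        μ (Preorder.frestrictLe (π := fun _ : ℕ => S) n ⁻¹' B) := by
    intro n B
    have hm := Preorder.measurable_frestrictLe (X := fun _ : ℕ => S) n
    have hB : MeasurableSet B := B.to_countable.measurableSet
    rw [← Measure.map_apply hm hB, ← Measure.map_apply hm hB,
      ← Measure.tsum_indicator_apply_singleton _ _ hB,
      ← Measure.tsum_indicator_apply_singleton _ _ hB]
    refine ENNReal.tsum_le_tsum fun y => ?_
    by_cases hy : y ∈ B
    · simp only [Set.indicator_of_mem hy]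
      rw [Measure.map_apply hm (measurableSet_singleton _),
        Measure.map_apply hm (measurableSet_singleton _)]
      by_cases hr : ∃ x : ℕ → S, Preorder.frestrictLe n x = y
      · obtain ⟨x, rfl⟩ := hr
        rw [← initialCylinder_eq_preimage]
        exact h x n
      · have : Preorder.frestrictLe (π := fun _ : ℕ => S) n ⁻¹' {y} = ∅ := by
          ext w
          simpa using fun hw => hr ⟨w, hw⟩
        simp [this]
    · simp [Set.indicator_of_notMem hy]
  have hopen : ∀ U : Set (ℕ → S), IsOpen U → ν U ≤ μ U := by
    intro U hU
    -- An open set is the increasing union of the sets of points whose cylinder of length `n`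
    -- already lies inside it.
    set V : ℕ → Set (ℕ → S) := fun n => {w | initialCylinder w n ⊆ U} with hV
    have hmono : Monotone V := fun m n hmn w hw z hz =>
      hw fun i hi => hz i (hi.trans hmn)
    have hUV : U = ⋃ n, V n := by
      ext w
      simp only [Set.mem_iUnion]
      constructor
      · intro hw
        obtain ⟨I, u, hu, hsub⟩ := isOpen_pi_iff.1 hU w hw
        refine ⟨I.sup id, fun z hz => hsub fun i hi => ?_⟩
        rw [hz i (Finset.le_sup (f := id) hi)]
        exact (hu i hi).2
      · rintro ⟨n, hn⟩
        exact hn fun _ _ => rfl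
    have hVn : ∀ n, ν (V n) ≤ μ (V n) := by
      intro n
      have : V n = Preorder.frestrictLe (π := fun _ : ℕ => S) n ⁻¹'
          (Preorder.frestrictLe (π := fun _ : ℕ => S) n '' V n) := by
        refine (Set.subset_preimage_image _ _).antisymm ?_
        rintro w ⟨z, hz, hzw⟩ y hy
        refine hz fun i hi => (hy i hi).trans ?_
        exact (congrFun hzw ⟨i, Finset.mem_Iic.2 hi⟩).symm
      rw [this]
      exact key n _
    rw [hUV, hmono.measure_iUnion, hmono.measure_iUnion]
    exact iSup_mono hVn
  refine Measure.le_iff.2 fun A _ => ?_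
  refine ENNReal.le_of_forall_pos_le_add fun ε hε _ => ?_
  obtain ⟨U, hAU, hU, hlt⟩ := A.exists_isOpen_lt_add (measure_ne_top μ A)
    (ENNReal.coe_pos.2 hε).ne'
  exact (measure_mono hAU).trans ((hopen U hU).trans hlt.le)

/-- The transition kernel of the process whose next state after `w s` has distribution `N w s`. -/
noncomputable def pathKernel (N : List S → S → PMF S) (n : ℕ) : Kernel (Finset.Iic n → S) S :=
  Kernel.ofFunOfCountable fun h =>
    (N (List.ofFn fun i : Fin n => h ⟨i, Finset.mem_Iic.2 i.2.le⟩)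
      (h ⟨n, Finset.mem_Iic.2 le_rfl⟩)).toMeasure

instance (N : List S → S → PMF S) (n : ℕ) : IsMarkovKernel (pathKernel N n) :=
  ⟨fun _ => PMF.toMeasure.isProbabilityMeasure _⟩

/-- The law of the process started in `s` whose next state after `w s` has distribution `N w s`. -/
noncomputable def pathMeasure (N : List S → S → PMF S) (s : S) : Measure (ℕ → S) :=
  Kernel.trajMeasure (X := fun _ => S) (Measure.dirac s) (pathKernel N)

instance (N : List S → S → PMF S) (s : S) : IsProbabilityMeasure (pathMeasure N s) := by
  unfold pathMeasure; infer_instance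

lemma pathMeasure_initialCylinder_zero (N : List S → S → PMF S) (s : S) (x : ℕ → S) :
    pathMeasure N s (initialCylinder x 0) = Set.indicator {s} 1 (x 0) := by
  have h : (pathMeasure N s).map (Preorder.frestrictLe 0) =
      (Measure.dirac s).map (MeasurableEquiv.piUnique (fun _ : Finset.Iic 0 => S)).symm := by
    rw [pathMeasure, Kernel.trajMeasure, Measure.map_comp _ _ (by fun_prop),
      Kernel.traj_map_frestrictLe, Kernel.partialTraj_self, Measure.id_comp]
  rw [initialCylinder_eq_preimage, ← Measure.map_apply (by fun_prop) (measurableSet_singleton _), h,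
    Measure.map_apply (by fun_prop) (measurableSet_singleton _), Measure.dirac_apply]
  by_cases hx : x 0 = s
  · have h' : (MeasurableEquiv.piUnique (fun _ : Finset.Iic 0 => S)).symm s =
        Preorder.frestrictLe 0 x := by
      ext i
      exact hx.symm.trans (congrArg x (Nat.le_zero.1 (Finset.mem_Iic.1 i.2)).symm)
    rw [Set.indicator_of_mem (by exact h'), Set.indicator_of_mem (by exact hx)]
    rfl
  · have h' : (MeasurableEquiv.piUnique (fun _ : Finset.Iic 0 => S)).symm s ≠
        Preorder.frestrictLe 0 x :=
      fun h' => hx (congrFun h' ⟨0, Finset.mem_Iic.2 le_rfl⟩).symm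
    rw [Set.indicator_of_notMem (by exact h'), Set.indicator_of_notMem (by exact hx)]

lemma pathMeasure_initialCylinder_succ (N : List S → S → PMF S) (s : S) (x : ℕ → S) (n : ℕ) :
    pathMeasure N s (initialCylinder x (n + 1)) =
      pathMeasure N s (initialCylinder x n) *
        N (List.ofFn fun i : Fin n => x i) (x n) (x (n + 1)) := by
  have h := Kernel.map_frestrictLe_trajMeasure_compProd_eq_map_trajMeasure
    (X := fun _ => S) (μ₀ := Measure.dirac s) (κ := pathKernel N) (a := n)
  have h2 := congrArg (fun m => m ({Preorder.frestrictLe n x} ×ˢ {x (n + 1)})) h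
  beta_reduce at h2
  rw [Measure.compProd_apply_prod (measurableSet_singleton _) (measurableSet_singleton _),
    Measure.restrict_singleton, lintegral_smul_measure, lintegral_dirac,
    Measure.map_apply (by fun_prop) (measurableSet_singleton _),
    Measure.map_apply (by fun_prop) (by measurability), ← initialCylinder_eq_preimage] at h2
  have h3 : pathKernel N n (Preorder.frestrictLe n x) {x (n + 1)} =
      N (List.ofFn fun i : Fin n => x i) (x n) (x (n + 1)) :=
    PMF.toMeasure_apply_singleton _ _ (measurableSet_singleton _)
  have h4 : initialCylinder x (n + 1) =
      (fun w : ℕ → S => (Preorder.frestrictLe (π := fun _ => S) n w, w (n + 1))) ⁻¹' ({Preorder.frestrictLe n x} ×ˢ {x (n + 1)}) := by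
    have : initialCylinder x (n + 1) = initialCylinder x n ∩ {w | w (n + 1) = x (n + 1)} := by
      ext w
      simp only [initialCylinder, Nat.le_succ_iff, Set.mem_inter_iff, Set.mem_ofPred_eq]
      grind
    rw [this, initialCylinder_eq_preimage]
    rfl
  rw [h4, pathMeasure, ← h2, h3, smul_eq_mul]

lemma pathMeasure_initialCylinder (N : List S → S → PMF S) (s : S) (x : ℕ → S) (n : ℕ) :
    pathMeasure N s (initialCylinder x n) = Set.indicator {s} 1 (x 0) *
      ∏ i ∈ Finset.range n, N (List.ofFn fun j : Fin i => x j) (x i) (x (i + 1)) := by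
  induction n with
  | zero => simp [pathMeasure_initialCylinder_zero]
  | succ n ih => rw [pathMeasure_initialCylinder_succ, ih, Finset.prod_range_succ, mul_assoc]

/-- One step of the process, followed by the process that remembers this step. -/
lemma pathMeasure_apply (N : List S → S → PMF S) (s : S) {A : Set (ℕ → S)} (hA : MeasurableSet A) :
    pathMeasure N s A =
      ∫⁻ t, pathMeasure (fun w => N (s :: w)) t (pathCons s ⁻¹' A) ∂(N [] s).toMeasure := by
  -- The right-hand side is itself a measure in `A`, so the identity only has to be checked on
  -- cylinders.
  set K : Kernel S (ℕ → S) := Kernel.ofFunOfCountable fun t =>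
    (pathMeasure (fun w => N (s :: w)) t).map (pathCons s) with hK
  have hKm : IsMarkovKernel K :=
    ⟨fun t => Measure.isProbabilityMeasure_map (measurable_pathCons s).aemeasurable⟩
  have hν : ∀ B, MeasurableSet B → (K ∘ₘ (N [] s).toMeasure) B =
      ∫⁻ t, pathMeasure (fun w => N (s :: w)) t (pathCons s ⁻¹' B) ∂(N [] s).toMeasure := by
    intro B hB
    rw [Measure.bind_apply hB K.measurable.aemeasurable]
    exact lintegral_congr fun t => Measure.map_apply (measurable_pathCons s) hB
  have := PMF.toMeasure.isProbabilityMeasure (N [] s)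
  have hcyl : ∀ x n, (K ∘ₘ (N [] s).toMeasure) (initialCylinder x n) =
      pathMeasure N s (initialCylinder x n) := by
    intro x n
    rw [hν _ (measurableSet_initialCylinder x n), pathMeasure_initialCylinder]
    by_cases hx : x 0 = s
    · cases n with
      | zero =>
        have : pathCons s ⁻¹' initialCylinder x 0 = Set.univ := by
          ext w; simp [initialCylinder, hx]
        simp [this, hx]
      | succ n =>
        simp only [preimage_pathCons_initialCylinder_succ hx, pathMeasure_initialCylinder]
        rw [lintegral_mul_const _ .of_discrete, Finset.prod_range_succ', mul_comm]
        have h1 : ∫⁻ t, Set.indicator {t} 1 (x (0 + 1)) ∂(N [] s).toMeasure = N [] s (x 1) := by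
          rw [← PMF.toMeasure_apply_singleton _ _ (measurableSet_singleton (x 1)),
            ← lintegral_indicator_one (measurableSet_singleton (x 1))]
          refine lintegral_congr fun t => ?_
          by_cases h : t = x 1
          · simp [h]
          · simp [h, Ne.symm h]
        rw [h1]
        simp [hx, List.ofFn_succ]
    · simp [preimage_pathCons_initialCylinder_of_ne hx, hx]
  rw [← hν A hA]
  exact le_antisymm (measure_le_of_initialCylinder (fun x n => (hcyl x n).ge) A)
    (measure_le_of_initialCylinder (fun x n => (hcyl x n).le) A)

lemma pathMeasure_ae_zero (N : List S → S → PMF S) (s : S) :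
    ∀ᵐ w ∂pathMeasure N s, w 0 = s := by
  have h : pathMeasure N s (initialCylinder (fun _ => s) 0) = 1 := by
    simp [pathMeasure_initialCylinder_zero]
  filter_upwards [(mem_ae_iff_prob_eq_one (measurableSet_initialCylinder _ _)).2 h] with w hw
    using hw 0 le_rfl

end MDP

/-! ### Optimal probabilities of reaching and of staying. -/

namespace MDP

variable {S : Type*} [MeasurableSpace S]

open Classical in
/-- The largest probability of visiting `T` within `n` steps, if in each state `s` the distribution
of the next state can be chosen from `D s`. -/
noncomputable def reachWithin (D : S → Set (PMF S)) (T : Set S) : ℕ → S → ℝ≥0∞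
  | 0, s => T.indicator 1 s
  | n + 1, s => if s ∈ T then 1 else ⨆ p ∈ D s, ∫⁻ t, reachWithin D T n t ∂p.toMeasure

/-- The supremum of the probabilities of visiting `T`, if in each state `s` the distribution of the
next state can be chosen from `D s`. -/
noncomputable def reach (D : S → Set (PMF S)) (T : Set S) (s : S) : ℝ≥0∞ :=
  ⨆ n, reachWithin D T n s

open Classical in
/-- The largest probability of staying in `H` for `n` steps, if in each state `s` the distribution
of the next state can be chosen from `D s`. -/
noncomputable def stayWithin (D : S → Set (PMF S)) (H : Set S) : ℕ → S → ℝ≥0∞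
  | 0, s => H.indicator 1 s
  | n + 1, s => if s ∈ H then ⨆ p ∈ D s, ∫⁻ t, stayWithin D H n t ∂p.toMeasure else 0

/-- The limit of the largest probabilities of staying in `H` for `n` steps. -/
noncomputable def stay (D : S → Set (PMF S)) (H : Set S) (s : S) : ℝ≥0∞ :=
  ⨅ n, stayWithin D H n s

variable {D : S → Set (PMF S)} {T H K : Set S} {s : S} {p : PMF S}

lemma lintegral_pmf_le_of_le {h : S → ℝ≥0∞} {c : ℝ≥0∞} (hc : ∀ t, h t ≤ c) :
    ∫⁻ t, h t ∂p.toMeasure ≤ c := by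
  have := PMF.toMeasure.isProbabilityMeasure p
  calc ∫⁻ t, h t ∂p.toMeasure ≤ ∫⁻ _, c ∂p.toMeasure := lintegral_mono hc
    _ = c := by simp

lemma reachWithin_of_mem (hs : s ∈ T) (n : ℕ) : reachWithin D T n s = 1 := by
  cases n <;> simp [reachWithin, hs]

lemma reachWithin_zero_of_notMem (hs : s ∉ T) : reachWithin D T 0 s = 0 := by
  simp [reachWithin, hs]

lemma reachWithin_succ_of_notMem (hs : s ∉ T) (n : ℕ) :
    reachWithin D T (n + 1) s = ⨆ p ∈ D s, ∫⁻ t, reachWithin D T n t ∂p.toMeasure := by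
  simp [reachWithin, hs]

lemma stayWithin_zero_of_mem (hs : s ∈ H) : stayWithin D H 0 s = 1 := by
  simp [stayWithin, hs]

lemma stayWithin_succ_of_mem (hs : s ∈ H) (n : ℕ) :
    stayWithin D H (n + 1) s = ⨆ p ∈ D s, ∫⁻ t, stayWithin D H n t ∂p.toMeasure := by
  simp [stayWithin, hs]

lemma stayWithin_of_notMem (hs : s ∉ H) (n : ℕ) : stayWithin D H n s = 0 := by
  cases n <;> simp [stayWithin, hs]

lemma lintegral_reachWithin_le (hs : s ∉ T) (hp : p ∈ D s) (n : ℕ) :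
    ∫⁻ t, reachWithin D T n t ∂p.toMeasure ≤ reachWithin D T (n + 1) s := by
  rw [reachWithin_succ_of_notMem hs]
  exact le_iSup₂_of_le p hp le_rfl

lemma lintegral_stayWithin_le (hs : s ∈ H) (hp : p ∈ D s) (n : ℕ) :
    ∫⁻ t, stayWithin D H n t ∂p.toMeasure ≤ stayWithin D H (n + 1) s := by
  rw [stayWithin_succ_of_mem hs]
  exact le_iSup₂_of_le p hp le_rfl

lemma reachWithin_le_one (n : ℕ) : ∀ s, reachWithin D T n s ≤ 1 := by
  induction n with
  | zero => intro s; by_cases hs : s ∈ T <;> simp [reachWithin, hs]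
  | succ n ih =>
    intro s
    by_cases hs : s ∈ T
    · rw [reachWithin_of_mem hs]
    · rw [reachWithin_succ_of_notMem hs]
      exact iSup₂_le fun p _ => lintegral_pmf_le_of_le ih

lemma stayWithin_le_one (n : ℕ) : ∀ s, stayWithin D H n s ≤ 1 := by
  induction n with
  | zero => intro s; by_cases hs : s ∈ H <;> simp [stayWithin, hs]
  | succ n ih =>
    intro s
    by_cases hs : s ∈ H
    · rw [stayWithin_succ_of_mem hs]
      exact iSup₂_le fun p _ => lintegral_pmf_le_of_le ih
    · simp [stayWithin_of_notMem hs]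

lemma reachWithin_le_succ (n : ℕ) : ∀ s, reachWithin D T n s ≤ reachWithin D T (n + 1) s := by
  induction n with
  | zero =>
    intro s
    by_cases hs : s ∈ T
    · simp [reachWithin_of_mem hs]
    · simp [reachWithin_zero_of_notMem hs]
  | succ n ih =>
    intro s
    by_cases hs : s ∈ T
    · simp [reachWithin_of_mem hs]
    · rw [reachWithin_succ_of_notMem hs, reachWithin_succ_of_notMem hs]
      exact iSup₂_mono fun p _ => lintegral_mono ih

lemma stayWithin_succ_le (n : ℕ) : ∀ s, stayWithin D H (n + 1) s ≤ stayWithin D H n s := by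
  induction n with
  | zero =>
    intro s
    by_cases hs : s ∈ H
    · rw [stayWithin_zero_of_mem hs]; exact stayWithin_le_one _ _
    · simp [stayWithin_of_notMem hs]
  | succ n ih =>
    intro s
    by_cases hs : s ∈ H
    · rw [stayWithin_succ_of_mem hs, stayWithin_succ_of_mem hs]
      exact iSup₂_mono fun p _ => lintegral_mono ih
    · simp [stayWithin_of_notMem hs]

lemma monotone_reachWithin : Monotone (reachWithin D T) :=
  monotone_nat_of_le_succ fun n => reachWithin_le_succ n

lemma antitone_stayWithin : Antitone (stayWithin D H) :=
  antitone_nat_of_succ_le fun n => stayWithin_succ_le n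

lemma reach_le_one (s : S) : reach D T s ≤ 1 := iSup_le fun n => reachWithin_le_one n s

lemma stay_le_one (s : S) : stay D H s ≤ 1 := (iInf_le _ 0).trans (stayWithin_le_one 0 s)

lemma reachWithin_le_reach (n : ℕ) (s : S) : reachWithin D T n s ≤ reach D T s :=
  le_iSup (fun n => reachWithin D T n s) n

lemma stay_le_stayWithin (n : ℕ) (s : S) : stay D H s ≤ stayWithin D H n s :=
  iInf_le (fun n => stayWithin D H n s) n

lemma reach_of_mem (hs : s ∈ T) : reach D T s = 1 := by
  simp [reach, reachWithin_of_mem hs]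

lemma stay_of_notMem (hs : s ∉ H) : stay D H s = 0 := by
  simp [stay, stayWithin_of_notMem hs]

lemma reachWithin_mono_right (h : K ⊆ T) (n : ℕ) :
    ∀ s, reachWithin D K n s ≤ reachWithin D T n s := by
  induction n with
  | zero => exact fun s => Set.indicator_le_indicator_of_subset h (fun _ => zero_le) s
  | succ n ih =>
    intro s
    by_cases hs : s ∈ T
    · rw [reachWithin_of_mem hs]; exact reachWithin_le_one _ s
    · rw [reachWithin_succ_of_notMem hs, reachWithin_succ_of_notMem fun h' => hs (h h')]
      exact iSup₂_mono fun p _ => lintegral_mono ih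

lemma reach_mono_right (h : K ⊆ T) (s : S) : reach D K s ≤ reach D T s :=
  iSup_mono fun n => reachWithin_mono_right h n s

lemma stayWithin_mono (h : K ⊆ H) (n : ℕ) : ∀ s, stayWithin D K n s ≤ stayWithin D H n s := by
  induction n with
  | zero => exact fun s => Set.indicator_le_indicator_of_subset h (fun _ => zero_le) s
  | succ n ih =>
    intro s
    by_cases hs : s ∈ K
    · rw [stayWithin_succ_of_mem hs, stayWithin_succ_of_mem (h hs)]
      exact iSup₂_mono fun p _ => lintegral_mono ih
    · simp [stayWithin_of_notMem hs]

lemma stay_mono (h : K ⊆ H) (s : S) : stay D K s ≤ stay D H s :=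
  iInf_mono fun n => stayWithin_mono h n s

lemma exists_forall_lintegral_le (hfin : (D s).Finite) (hne : (D s).Nonempty) (h : S → ℝ≥0∞) :
    ∃ p ∈ D s, ∀ q ∈ D s, ∫⁻ t, h t ∂q.toMeasure ≤ ∫⁻ t, h t ∂p.toMeasure :=
  Set.exists_max_image (D s) (fun p => ∫⁻ t, h t ∂p.toMeasure) hfin hne

variable [DiscreteMeasurableSpace S]

/-- Monotone convergence passes to the limit in the recursion, with no finiteness of the decision
sets. -/
lemma lintegral_reach_le (hs : s ∉ T) (hp : p ∈ D s) :
    ∫⁻ t, reach D T t ∂p.toMeasure ≤ reach D T s := by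
  unfold reach
  rw [lintegral_iSup (fun _ => .of_discrete) monotone_reachWithin]
  exact iSup_le fun n => (lintegral_reachWithin_le hs hp n).trans (reachWithin_le_reach _ _)

/-- If the probability of visiting `T` can be bounded away from zero from all states, it can be made
arbitrarily close to one. -/
lemma reach_eq_one_of_le {c : ℝ≥0∞} (hc0 : c ≠ 0) (hc : ∀ s, c ≤ reach D T s) (s : S) :
    reach D T s = 1 := by
  have hc1 : c ≤ 1 := (hc s).trans (reach_le_one s)
  have hct : c ≠ ∞ := ne_top_of_le_ne_top ENNReal.one_ne_top hc1
  -- If `T` has not been visited after `n` steps, a fresh attempt still succeeds with probability at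
  -- least `c`. As `n` grows this becomes `r * (1 - c) + c ≤ r`, which forces `r = 1`.
  have key : ∀ n s, reachWithin D T n s * (1 - c) + c ≤ reach D T s := by
    intro n
    induction n with
    | zero =>
      intro s
      by_cases hs : s ∈ T
      · simp [reachWithin_of_mem hs, reach_of_mem hs, tsub_add_cancel_of_le hc1]
      · simpa [reachWithin_zero_of_notMem hs] using hc s
    | succ n ih =>
      intro s
      by_cases hs : s ∈ T
      · simp [reachWithin_of_mem hs, reach_of_mem hs, tsub_add_cancel_of_le hc1]
      · suffices h : reachWithin D T (n + 1) s * (1 - c) ≤ reach D T s - c by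
          calc _ ≤ reach D T s - c + c := by gcongr
            _ = _ := tsub_add_cancel_of_le (hc s)
        rw [reachWithin_succ_of_notMem hs]
        simp only [ENNReal.iSup_mul]
        refine iSup₂_le fun p hp => ENNReal.le_sub_of_add_le_right hct ?_
        have := PMF.toMeasure.isProbabilityMeasure p
        calc _ = ∫⁻ t, (reachWithin D T n t * (1 - c) + c) ∂p.toMeasure := by
              rw [lintegral_add_right _ .of_discrete, lintegral_mul_const _ .of_discrete]; simp
          _ ≤ ∫⁻ t, reach D T t ∂p.toMeasure := lintegral_mono ih
          _ ≤ _ := lintegral_reach_le hs hp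
  refine le_antisymm (reach_le_one s) ?_
  have h1 : reach D T s * (1 - c) + c ≤ reach D T s := by
    have : reach D T s * (1 - c) ≤ reach D T s - c := by
      rw [reach, ENNReal.iSup_mul]
      exact iSup_le fun n => ENNReal.le_sub_of_add_le_right hct (key n s)
    calc _ ≤ reach D T s - c + c := by gcongr
      _ = _ := tsub_add_cancel_of_le (hc s)
  have hrt : reach D T s ≠ ∞ := ne_top_of_le_ne_top ENNReal.one_ne_top (reach_le_one s)
  have h2 : reach D T s = reach D T s * (1 - c) + reach D T s * c := by
    rw [← mul_add, tsub_add_cancel_of_le hc1, mul_one]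
  have h3 : reach D T s * (1 - c) + c ≤ reach D T s * (1 - c) + reach D T s * c := by
    rwa [← h2]
  have h4 : c ≤ reach D T s * c :=
    (ENNReal.add_le_add_iff_left (ENNReal.mul_ne_top hrt (by simp))).1 h3
  by_contra! hlt
  exact absurd h4 (not_le.2 (by
    simpa using ENNReal.mul_lt_mul_left hc0 hct hlt))

/-- A bounded function that decreases by a fixed factor in expectation before `T` is visited is a
lower bound for the probability of visiting `T`. -/
lemma le_reach_of_le_mul_lintegral {h : S → ℝ≥0∞} {β : ℝ≥0∞} (hβ : β < 1) (h1 : ∀ s, h s ≤ 1)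
    (hh : ∀ s ∉ T, ∃ p ∈ D s, h s ≤ β * ∫⁻ t, h t ∂p.toMeasure) (s : S) :
    h s ≤ reach D T s := by
  -- The discount makes the contribution of plays that have not yet met `T` vanish in the limit.
  have key : ∀ n s, h s ≤ reachWithin D T n s + β ^ n := by
    intro n
    induction n with
    | zero => intro s; simpa using (h1 s).trans le_add_self
    | succ n ih =>
      intro s
      by_cases hs : s ∈ T
      · rw [reachWithin_of_mem hs]; exact (h1 s).trans le_self_add
      · obtain ⟨p, hp, hle⟩ := hh s hs
        have := PMF.toMeasure.isProbabilityMeasure p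
        calc h s ≤ β * ∫⁻ t, h t ∂p.toMeasure := hle
          _ ≤ β * ∫⁻ t, (reachWithin D T n t + β ^ n) ∂p.toMeasure := by
              gcongr with t; exact ih t
          _ = β * (∫⁻ t, reachWithin D T n t ∂p.toMeasure) + β ^ (n + 1) := by
              rw [lintegral_add_right _ .of_discrete, mul_add]; simp [pow_succ, mul_comm]
          _ ≤ 1 * reachWithin D T (n + 1) s + β ^ (n + 1) := by
              gcongr; exact lintegral_reachWithin_le hs hp n
          _ = _ := by rw [one_mul]
  have hlim : Tendsto (fun n => reach D T s + β ^ n) atTop (nhds (reach D T s + 0)) :=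
    tendsto_const_nhds.add (ENNReal.tendsto_pow_atTop_nhds_zero_of_lt_one hβ)
  rw [add_zero] at hlim
  exact ge_of_tendsto' hlim fun n => (key n s).trans (by gcongr; exact reachWithin_le_reach n s)

/-! ### Memoryless almost sure reachability. -/

lemma half_le_two_mul_sub_one {d : ℝ≥0∞} (hd : 3 / 4 ≤ d) : 2⁻¹ ≤ 2 * d - 1 := by
  refine ENNReal.le_sub_of_add_le_right (by simp) ?_
  calc (2⁻¹ : ℝ≥0∞) + 1 = 2 * (3 / 4) := by
        refine (ENNReal.toReal_eq_toReal_iff' (by finiteness) (by finiteness)).1 ?_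
        rw [ENNReal.toReal_add (by finiteness) (by finiteness)]
        norm_num
    _ ≤ 2 * d := by gcongr

lemma two_mul_sub_one_le_one {d : ℝ≥0∞} (hd : d ≤ 1) : 2 * d - 1 ≤ 1 := by
  rw [tsub_le_iff_right]
  calc 2 * d ≤ 2 * 1 := by gcongr
    _ = 1 + 1 := by norm_num

lemma two_mul_sub_one_eq_zero {d : ℝ≥0∞} (hd : ¬ 2⁻¹ ≤ d) : 2 * d - 1 = 0 := by
  rw [tsub_eq_zero_iff_le]
  calc 2 * d ≤ 2 * 2⁻¹ := by gcongr; exact (not_le.1 hd).le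
    _ = 1 := ENNReal.mul_inv_cancel (by simp) (by simp)

/-- Truncated subtraction gives `2 * d - 1` the value zero wherever `d` is below 1/2. There the
inequality is trivial for every decision, so only the decisions where `d` is at least 1/2 have to be
frozen. -/
lemma two_mul_sub_one_le_lintegral {d : S → ℝ≥0∞} {β : ℝ≥0∞} (hβ : β ≤ 1)
    (h : d s ≤ β * ∫⁻ t, d t ∂p.toMeasure) :
    2 * d s - 1 ≤ β * ∫⁻ t, (2 * d t - 1) ∂p.toMeasure := by
  have := PMF.toMeasure.isProbabilityMeasure p
  rw [tsub_le_iff_right]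
  calc 2 * d s ≤ 2 * (β * ∫⁻ t, d t ∂p.toMeasure) := by gcongr
    _ = β * ∫⁻ t, 2 * d t ∂p.toMeasure := by rw [lintegral_const_mul _ .of_discrete]; ring
    _ ≤ β * ∫⁻ t, ((2 * d t - 1) + 1) ∂p.toMeasure := by gcongr with t; exact le_tsub_add
    _ = β * (∫⁻ t, (2 * d t - 1) ∂p.toMeasure) + β := by
        rw [lintegral_add_right _ .of_discrete, mul_add]; simp
    _ ≤ _ := by gcongr

/-- The decisions can be restricted in such a way that `T` can still be reached from all states, and
that it is visited from `s` with probability at least one half whatever is decided. -/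
lemma exists_restriction_half_le_reach (hfin : ∀ s, (D s).Finite) (hne : ∀ s, (D s).Nonempty)
    (h1 : ∀ s, reach D T s = 1) (s : S) :
    ∃ D' : S → Set (PMF S), (∀ t, D' t ⊆ D t) ∧ (∀ t, (D' t).Nonempty) ∧
      (∀ t, reach D' T t = 1) ∧
      ∀ g : S → PMF S, (∀ t, g t ∈ D' t) → 2⁻¹ ≤ reach (fun t => {g t}) T s := by
  obtain ⟨n, hn⟩ : ∃ n, 3 / 4 < reachWithin D T n s := by
    refine lt_iSup_iff.1 (lt_of_lt_of_eq ?_ (h1 s).symm)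
    exact ENNReal.div_lt_of_lt_mul (by norm_num)
  -- A discount close enough to one leaves the discounted value at `s` above 3/4.
  obtain ⟨β, hβ, hβ1⟩ : ∃ β : ℝ≥0∞, 3 / 4 < β ^ n * reachWithin D T n s ∧ β < 1 := by
    have hc : Tendsto (fun β : ℝ≥0∞ => β ^ n * reachWithin D T n s) (nhds 1)
        (nhds (1 ^ n * reachWithin D T n s)) := by
      refine ENNReal.Tendsto.mul_const (ENNReal.continuous_pow n).continuousAt (Or.inr ?_)
      exact ne_top_of_le_ne_top ENNReal.one_ne_top (reachWithin_le_one n s)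
    rw [one_pow, one_mul] at hc
    have : (nhdsWithin (1 : ℝ≥0∞) (Set.Iio 1)).NeBot := nhdsLT_neBot_of_exists_lt ⟨0, by simp⟩
    have hlt : ∀ᶠ β in nhdsWithin (1 : ℝ≥0∞) (Set.Iio 1), β < 1 := self_mem_nhdsWithin
    exact (((hc.eventually (lt_mem_nhds hn)).filter_mono nhdsWithin_le_nhds).and hlt).exists
  set d : S → ℝ≥0∞ := fun t => ⨆ n, β ^ n * reachWithin D T n t with hd
  have hd1 : ∀ t, d t ≤ 1 := fun t => iSup_le fun n =>
    mul_le_one' (pow_le_one' hβ1.le n) (reachWithin_le_one n t)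
  have hdT : ∀ t ∈ T, d t = 1 := fun t ht => le_antisymm (hd1 t)
    (le_iSup_of_le 0 (by simp [reachWithin_of_mem ht]))
  choose f hf hfmax using fun t => exists_forall_lintegral_le (hfin t) (hne t) d
  have hdf : ∀ t ∉ T, d t ≤ β * ∫⁻ r, d r ∂(f t).toMeasure := by
    intro t ht
    refine iSup_le fun n => ?_
    cases n with
    | zero => simp [reachWithin_zero_of_notMem ht]
    | succ n =>
      rw [reachWithin_succ_of_notMem ht, pow_succ', mul_assoc]
      gcongr
      simp only [ENNReal.mul_iSup]
      refine iSup₂_le fun p hp => le_trans ?_ (hfmax t p hp)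
      rw [← lintegral_const_mul _ .of_discrete]
      exact lintegral_mono fun r => le_iSup (fun n => β ^ n * reachWithin D T n r) n
  classical
  -- Decisions are frozen to maximisers of the discounted value, but only where that value is at
  -- least 1/2; elsewhere they stay free.
  set D' : S → Set (PMF S) := fun t => if 2⁻¹ ≤ d t then {f t} else D t with hD'
  have hfD' : ∀ t, f t ∈ D' t := by
    intro t
    by_cases ht : 2⁻¹ ≤ d t <;> simp [hD', ht, hf t]
  have hdD' : ∀ t, d t ≤ reach D' T t :=
    le_reach_of_le_mul_lintegral hβ1 hd1 fun t ht => ⟨f t, hfD' t, hdf t ht⟩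
  refine ⟨D', fun t => ?_, fun t => ⟨f t, hfD' t⟩, ?_, fun g hg => ?_⟩
  · by_cases ht : 2⁻¹ ≤ d t <;> simp [hD', ht, hf t]
  -- Follow `D` until a frozen state is met; from there `f` reaches `T` with probability at least
  -- 1/2. The uniform bound is then amplified to one.
  · have key : ∀ n t, 2⁻¹ * reachWithin D T n t ≤ reach D' T t := by
      intro n
      induction n with
      | zero =>
        intro t
        by_cases ht : t ∈ T
        · rw [reach_of_mem ht, reachWithin_of_mem ht]; simp
        · simp [reachWithin_zero_of_notMem ht]
      | succ n ih =>
        intro t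
        by_cases ht : t ∈ T
        · rw [reach_of_mem ht, reachWithin_of_mem ht]; simp
        by_cases hdt : 2⁻¹ ≤ d t
        · calc _ ≤ 2⁻¹ * (1 : ℝ≥0∞) := by gcongr; exact reachWithin_le_one _ _
            _ ≤ d t := by simpa using hdt
            _ ≤ _ := hdD' t
        · rw [reachWithin_succ_of_notMem ht]
          simp only [ENNReal.mul_iSup]
          refine iSup₂_le fun p hp => ?_
          rw [← lintegral_const_mul _ .of_discrete]
          exact (lintegral_mono (ih ·)).trans (lintegral_reach_le ht (by simpa [hD', hdt] using hp))
    refine reach_eq_one_of_le (c := 2⁻¹) (by simp) fun t => ?_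
    calc (2⁻¹ : ℝ≥0∞) = 2⁻¹ * reach D T t := by rw [h1 t, mul_one]
      _ ≤ _ := by rw [reach, ENNReal.mul_iSup]; exact iSup_le fun n => key n t
  · have h2 : 3 / 4 ≤ d s := hβ.le.trans (le_iSup (fun n => β ^ n * reachWithin D T n s) n)
    refine (half_le_two_mul_sub_one h2).trans (le_reach_of_le_mul_lintegral
      (h := fun t => 2 * d t - 1) hβ1 (fun t => two_mul_sub_one_le_one (hd1 t)) ?_ s)
    intro t ht
    refine ⟨g t, rfl, ?_⟩
    by_cases hdt : 2⁻¹ ≤ d t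
    · have hgt : g t = f t := by simpa [hD', hdt] using hg t
      rw [hgt]
      exact two_mul_sub_one_le_lintegral hβ1.le (hdf t ht)
    · simp [two_mul_sub_one_eq_zero hdt]

/-- If `T` can be reached from all states with probability arbitrarily close to one, then there is a
memoryless decision rule that reaches it almost surely from all states. -/
lemma exists_reach_singleton_eq_one [Countable S] (hfin : ∀ s, (D s).Finite)
    (hne : ∀ s, (D s).Nonempty) (h1 : ∀ s, reach D T s = 1) :
    ∃ g : S → PMF S, (∀ s, g s ∈ D s) ∧ ∀ s, reach (fun t => {g t}) T s = 1 := by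
  rcases isEmpty_or_nonempty S with hS | hS
  · exact ⟨isEmptyElim, isEmptyElim, isEmptyElim⟩
  obtain ⟨e, he⟩ := exists_surjective_nat S
  let X := {E : S → Set (PMF S) // (∀ s, (E s).Finite) ∧ (∀ s, (E s).Nonempty) ∧
    ∀ s, reach E T s = 1}
  have hstep : ∀ (E : X) (s : S), ∃ E' : X, (∀ t, E'.1 t ⊆ E.1 t) ∧
      ∀ g : S → PMF S, (∀ t, g t ∈ E'.1 t) → 2⁻¹ ≤ reach (fun t => {g t}) T s := by
    intro E s
    obtain ⟨E', hsub, hne', h1', hg⟩ :=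
      exists_restriction_half_le_reach E.2.1 E.2.2.1 E.2.2.2 s
    exact ⟨⟨E', fun t => (E.2.1 t).subset (hsub t), hne', h1'⟩, hsub, hg⟩
  choose next hsub hnext using hstep
  let seq : ℕ → X := fun n => Nat.rec ⟨D, hfin, hne, h1⟩ (fun n E => next E (e n)) n
  have hanti : ∀ s, Antitone fun n => (seq n).1 s := fun s =>
    antitone_nat_of_succ_le fun n => hsub (seq n) (e n) s
  -- Compactness: a decreasing sequence of nonempty subsets of a finite set has a common element.
  have hinter : ∀ s, ∃ p, ∀ n, p ∈ (seq n).1 s := by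
    intro s
    by_contra! hcon
    choose m hm using hcon
    obtain ⟨N, hN⟩ := ((hfin s).image m).bddAbove
    obtain ⟨p, hp⟩ := (seq N).2.2.1 s
    have hpD : p ∈ D s := hanti s (Nat.zero_le N) hp
    exact hm p (hanti s (hN ⟨p, hpD, rfl⟩) hp)
  choose g hg using hinter
  -- Stage `n` secures the bound 1/2 from the state `e n` for every later selection, and the
  -- enumeration covers all states.
  refine ⟨g, fun s => hg s 0, reach_eq_one_of_le (c := 2⁻¹) (by simp) fun s => ?_⟩
  obtain ⟨n, rfl⟩ := he s
  exact hnext (seq n) (e n) g fun t => hg t (n + 1)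

/-! ### Staying in a set, and combining staying with reaching. -/

/-- In states of `H`, some decision preserves the probability of staying in `H`. -/
lemma exists_stay_le_lintegral (hfin : (D s).Finite) (hne : (D s).Nonempty) (hs : s ∈ H) :
    ∃ p ∈ D s, stay D H s ≤ ∫⁻ t, stay D H t ∂p.toMeasure := by
  by_contra! hcon
  have hlt : ∀ p ∈ D s, ∃ n, ∫⁻ t, stayWithin D H n t ∂p.toMeasure < stay D H s := by
    intro p hp
    have h := hcon p hp
    have := PMF.toMeasure.isProbabilityMeasure p
    have h' : ∫⁻ t, stay D H t ∂p.toMeasure = ⨅ n, ∫⁻ t, stayWithin D H n t ∂p.toMeasure := by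
      unfold stay
      refine lintegral_iInf (fun _ => .of_discrete) antitone_stayWithin ?_
      exact ne_top_of_le_ne_top ENNReal.one_ne_top
        (lintegral_pmf_le_of_le (stayWithin_le_one 0))
    rw [h'] at h
    exact iInf_lt_iff.1 h
  -- If each decision fails at some finite horizon, finiteness gives a horizon `N` at which all
  -- fail, contradicting the best decision for that horizon.
  choose! m hm using hlt
  obtain ⟨N, hN⟩ := (hfin.image m).bddAbove
  obtain ⟨p, hp, hmax⟩ := exists_forall_lintegral_le hfin hne (stayWithin D H N)
  have h1 : stay D H s ≤ ∫⁻ t, stayWithin D H N t ∂p.toMeasure := by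
    refine (stay_le_stayWithin (N + 1) s).trans ?_
    rw [stayWithin_succ_of_mem hs]
    exact iSup₂_le hmax
  refine absurd (hm p hp) (not_lt.2 (h1.trans (lintegral_mono fun t => ?_)))
  exact antitone_stayWithin (hN ⟨p, hp, rfl⟩) t

/-- A function that vanishes off `H` and does not decrease in expectation under suitable decisions
can only get its mass from paths that are still in `H`, where it is at most `c`. -/
lemma le_mul_stay {h : S → ℝ≥0∞} {c : ℝ≥0∞} (hct : c ≠ ∞) (hc : ∀ s ∈ H, h s ≤ c)
    (h0 : ∀ s ∉ H, h s = 0) (hh : ∀ s ∈ H, ∃ p ∈ D s, h s ≤ ∫⁻ t, h t ∂p.toMeasure) (s : S) :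
    h s ≤ c * stay D H s := by
  have key : ∀ n s, h s ≤ c * stayWithin D H n s := by
    intro n
    induction n with
    | zero =>
      intro s
      by_cases hs : s ∈ H
      · simpa [stayWithin_zero_of_mem hs] using hc s hs
      · simp [h0 s hs]
    | succ n ih =>
      intro s
      by_cases hs : s ∈ H
      · obtain ⟨p, hp, hle⟩ := hh s hs
        calc h s ≤ ∫⁻ t, h t ∂p.toMeasure := hle
          _ ≤ ∫⁻ t, c * stayWithin D H n t ∂p.toMeasure := lintegral_mono (ih ·)
          _ = c * ∫⁻ t, stayWithin D H n t ∂p.toMeasure := lintegral_const_mul _ .of_discrete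
          _ ≤ _ := by gcongr; exact lintegral_stayWithin_le hs hp n
      · simp [h0 s hs]
  rw [stay, ENNReal.mul_iInf fun h => absurd h hct]
  exact le_iInf fun n => key n s

/-- One cannot stay in a set of states in which the probability of staying in a larger set is
bounded away from one. -/
lemma stay_eq_zero_of_subset (hfin : ∀ s, (D s).Finite) (hne : ∀ s, (D s).Nonempty) (hKH : K ⊆ H)
    {c : ℝ≥0∞} (hc1 : c < 1) (hc : ∀ s ∈ K, stay D H s ≤ c) (s : S) : stay D K s = 0 := by
  -- Taking the staying probability of `K` as test function gives `stay D K s ≤ c * stay D K s`.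
  have h := le_mul_stay (D := D) (H := K) (h := stay D K) (ne_top_of_lt hc1)
    (fun s hs => (stay_mono hKH s).trans (hc s hs)) (fun s hs => stay_of_notMem hs)
    (fun s hs => exists_stay_le_lintegral (hfin s) (hne s) hs) s
  by_contra h0
  have hlt := ENNReal.mul_lt_mul_left h0
    (ne_top_of_le_ne_top ENNReal.one_ne_top (stay_le_one (D := D) (H := K) s)) hc1
  rw [one_mul] at hlt
  exact absurd h (not_le.2 hlt)

/-- If every set that contains the colour `2`, and that cannot be avoided within the colour `0`, can
be reached with probability arbitrarily close to one, then a memoryless decision rule visits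
almost surely the colour `2` or a state from which it stays in the colour `0` with probability
at least one half. -/
lemma exists_reach_two_or_stay_zero [Countable S] (hfin : ∀ s, (D s).Finite)
    (hne : ∀ s, (D s).Nonempty) (col : S → ℕ)
    (hreach : ∀ T : Set S, (∀ s, col s = 2 → s ∈ T) → (∀ s, stay D ({t | col t = 0} \ T) s = 0) →
      ∀ s, reach D T s = 1) :
    ∃ g : S → PMF S, (∀ s, g s ∈ D s) ∧ ∀ s, reach (fun t => {g t})
      ({t | col t = 2} ∪ {t | 2⁻¹ ≤ stay (fun r => {g r}) {r | col r = 0} t}) s = 1 := by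
  classical
  set Z : Set S := {t | col t = 0}
  set v : S → ℝ≥0∞ := stay D Z
  -- Two thresholds: decisions are frozen from 1/2 upwards, while the target demands 3/4, because `2
  -- * (3/4) - 1 = 1/2` is what survives in colour 0 under every later choice of unfrozen decisions.
  set G : Set S := {t | col t = 2} ∪ {t | 2⁻¹ ≤ v t}
  set T : Set S := {t | col t = 2} ∪ {t | 3 / 4 ≤ v t}
  have h34 : (3 / 4 : ℝ≥0∞) < 1 := ENNReal.div_lt_of_lt_mul (by norm_num)
  have h24 : (2⁻¹ : ℝ≥0∞) ≤ 3 / 4 := by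
    refine (ENNReal.toReal_le_toReal (by finiteness) (by finiteness)).1 ?_
    norm_num
  have hG : ∀ s, reach D G s = 1 := by
    refine hreach G (fun s hs => Or.inl hs) (stay_eq_zero_of_subset hfin hne Set.sdiff_subset
      (c := 2⁻¹) (by simp) fun s hs => ?_)
    exact (not_le.1 fun h => hs.2 (Or.inr h)).le
  have hZT : ∀ s, stay D (Z \ T) s = 0 := by
    refine stay_eq_zero_of_subset hfin hne Set.sdiff_subset h34 fun s hs => ?_
    exact (not_le.1 fun h => hs.2 (Or.inr h)).le
  have hf : ∀ s, ∃ p ∈ D s, s ∈ Z → v s ≤ ∫⁻ t, v t ∂p.toMeasure := by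
    intro s
    by_cases hs : s ∈ Z
    · obtain ⟨p, hp, h⟩ := exists_stay_le_lintegral (hfin s) (hne s) hs
      exact ⟨p, hp, fun _ => h⟩
    · exact (hne s).imp fun p hp => ⟨hp, fun h => absurd h hs⟩
  choose f hfD hf using hf
  set D' : S → Set (PMF S) := fun t => if 2⁻¹ ≤ v t then {f t} else D t with hD'
  have hD'D : ∀ t, D' t ⊆ D t := by
    intro t
    by_cases ht : 2⁻¹ ≤ v t <;> simp [hD', ht, hfD t]
  have hfD' : ∀ t, f t ∈ D' t := by
    intro t
    by_cases ht : 2⁻¹ ≤ v t <;> simp [hD', ht, hfD t]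
  -- Under `f` the value `v` is preserved in expectation inside `Z`, and staying in `Z \ T` has
  -- probability zero, so its mass must arrive in `T`.
  have hv : ∀ s, v s ≤ reach D' T s := by
    have key : ∀ n s, v s ≤ reach D' T s + stayWithin D (Z \ T) n s := by
      intro n
      induction n with
      | zero =>
        intro s
        by_cases hsT : s ∈ T
        · rw [reach_of_mem hsT]; exact (stay_le_one s).trans le_self_add
        by_cases hsZ : s ∈ Z
        · have hs : s ∈ Z \ T := ⟨hsZ, hsT⟩
          rw [stayWithin_zero_of_mem hs]; exact (stay_le_one s).trans le_add_self
        · rw [show v s = 0 from stay_of_notMem hsZ]; exact zero_le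
      | succ n ih =>
        intro s
        by_cases hsT : s ∈ T
        · rw [reach_of_mem hsT]; exact (stay_le_one s).trans le_self_add
        by_cases hsZ : s ∈ Z
        · have hs : s ∈ Z \ T := ⟨hsZ, hsT⟩
          calc v s ≤ ∫⁻ t, v t ∂(f s).toMeasure := hf s hsZ
            _ ≤ ∫⁻ t, (reach D' T t + stayWithin D (Z \ T) n t) ∂(f s).toMeasure :=
                lintegral_mono ih
            _ = ∫⁻ t, reach D' T t ∂(f s).toMeasure +
                  ∫⁻ t, stayWithin D (Z \ T) n t ∂(f s).toMeasure :=
                lintegral_add_right _ .of_discrete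
            _ ≤ _ := add_le_add (lintegral_reach_le hsT (hfD' s))
                (lintegral_stayWithin_le hs (hfD s) n)
        · rw [show v s = 0 from stay_of_notMem hsZ]; exact zero_le
    intro s
    calc v s ≤ ⨅ n, (reach D' T s + stayWithin D (Z \ T) n s) := le_iInf fun n => key n s
      _ = reach D' T s + stay D (Z \ T) s := by rw [stay, ENNReal.add_iInf]
      _ = reach D' T s := by rw [hZT, add_zero]
  -- Outside `G` no decision is frozen, so `G` is as reachable as before; from `G` the bound `hv`
  -- gives at least 1/2.
  have hhalf : ∀ n s, 2⁻¹ * reachWithin D G n s ≤ reach D' T s := by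
    have hsG : ∀ n, ∀ s ∈ G, 2⁻¹ * reachWithin D G n s ≤ reach D' T s := by
      intro n s hs
      rw [reachWithin_of_mem hs, mul_one]
      rcases hs with hs | hs
      · have hsT : s ∈ T := Or.inl hs
        rw [reach_of_mem hsT]; simp
      · exact le_trans hs (hv s)
    intro n
    induction n with
    | zero =>
      intro s
      by_cases hs : s ∈ G
      · exact hsG 0 s hs
      · simp [reachWithin_zero_of_notMem hs]
    | succ n ih =>
      intro s
      by_cases hs : s ∈ G
      · exact hsG _ s hs
      have hs2 : ¬ 2⁻¹ ≤ v s := fun h => hs (Or.inr h)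
      have hsT : s ∉ T := by
        rintro (h | h)
        · exact hs (Or.inl h)
        · exact hs2 (h24.trans h)
      rw [reachWithin_succ_of_notMem hs]
      simp only [ENNReal.mul_iSup]
      refine iSup₂_le fun p hp => ?_
      rw [← lintegral_const_mul _ .of_discrete]
      exact (lintegral_mono (ih ·)).trans (lintegral_reach_le hsT (by simpa [hD', hs2] using hp))
  have hreach' : ∀ s, reach D' T s = 1 := by
    refine reach_eq_one_of_le (c := 2⁻¹) (by simp) fun s => ?_
    calc (2⁻¹ : ℝ≥0∞) = 2⁻¹ * reach D G s := by rw [hG s, mul_one]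
      _ ≤ _ := by rw [reach, ENNReal.mul_iSup]; exact iSup_le fun n => hhalf n s
  obtain ⟨g, hg, hg1⟩ := exists_reach_singleton_eq_one (fun s => (hfin s).subset (hD'D s))
    (fun s => ⟨f s, hfD' s⟩) hreach'
  refine ⟨g, fun s => hD'D s (hg s), fun s => le_antisymm (reach_le_one s) ?_⟩
  rw [← hg1 s]
  refine reach_mono_right (Set.union_subset_union_right _ fun t ht => ?_) s
  -- The truncated `2 * v - 1` is a valid test function for `g`: where it is nonzero, `g` agrees
  -- with `f`.
  refine (half_le_two_mul_sub_one ht).trans ?_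
  rw [← one_mul (stay _ _ t)]
  refine le_mul_stay (h := fun t => 2 * v t - 1) ENNReal.one_ne_top
    (fun r _ => two_mul_sub_one_le_one (stay_le_one r)) (fun r hr => ?_) (fun r hr => ?_) t
  · simp [show v r = 0 from stay_of_notMem hr]
  · refine ⟨g r, rfl, ?_⟩
    by_cases h2 : 2⁻¹ ≤ v r
    · have hgr : g r = f r := by simpa [hD', h2] using hg r
      rw [hgr, ← one_mul (lintegral _ _)]
      exact two_mul_sub_one_le_lintegral le_rfl (by simpa using hf r hr)
    · simp [two_mul_sub_one_eq_zero h2]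

end MDP

/-! ### Markov chains and the parity objective. -/

namespace MDP

variable {S : Type*}

lemma preimage_pathCons_forall_le_mem {H : Set S} {s : S} (hs : s ∈ H) (n : ℕ) :
    pathCons s ⁻¹' {w | ∀ i ≤ n + 1, w i ∈ H} = {w | ∀ i ≤ n, w i ∈ H} := by
  ext w
  constructor
  · intro h i hi
    exact h (i + 1) (by lia)
  · intro h i hi
    cases i with
    | zero => exact hs
    | succ i => exact h i (by lia)

lemma iInter_forall_le_mem (H : Set S) :
    {w : ℕ → S | ∀ n, w n ∈ H} = ⋂ n, {w : ℕ → S | ∀ i ≤ n, w i ∈ H} := by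
  ext w
  simp only [Set.mem_iInter]
  exact ⟨fun h n i _ => h i, fun h n => h n n le_rfl⟩

lemma antitone_forall_le_mem (H : Set S) : Antitone fun n => {w : ℕ → S | ∀ i ≤ n, w i ∈ H} :=
  fun _ _ hmn _ hw i hi => hw i (hi.trans hmn)

variable [MeasurableSpace S] [DiscreteMeasurableSpace S]

lemma measurableSet_forall_mem (H : Set S) : MeasurableSet {w : ℕ → S | ∀ n, w n ∈ H} := by
  have : {w : ℕ → S | ∀ n, w n ∈ H} = ⋂ n, (fun w => w n) ⁻¹' H := by ext; simp
  rw [this]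
  exact .iInter fun n => measurable_pi_apply n .of_discrete

lemma measurableSet_forall_le_mem (H : Set S) (n : ℕ) :
    MeasurableSet {w : ℕ → S | ∀ i ≤ n, w i ∈ H} := by
  have : {w : ℕ → S | ∀ i ≤ n, w i ∈ H} = ⋂ i, ⋂ (_ : i ≤ n), (fun w => w i) ⁻¹' H := by
    ext; simp
  rw [this]
  exact .iInter fun i => .iInter fun _ => measurable_pi_apply i .of_discrete

variable [Countable S] {g : S → PMF S}

/-- The law of the Markov chain with transition probabilities `g`, started in `s`. -/
noncomputable abbrev chain (g : S → PMF S) (s : S) : Measure (ℕ → S) := pathMeasure (fun _ => g) s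

lemma chain_apply (g : S → PMF S) (s : S) {A : Set (ℕ → S)} (hA : MeasurableSet A) :
    chain g s A = ∫⁻ t, chain g t (pathCons s ⁻¹' A) ∂(g s).toMeasure :=
  pathMeasure_apply _ s hA

lemma stay_le_chain (g : S → PMF S) (H : Set S) (s : S) :
    stay (fun t => {g t}) H s ≤ chain g s {w | ∀ n, w n ∈ H} := by
  have key : ∀ n s, stayWithin (fun t => {g t}) H n s ≤ chain g s {w | ∀ i ≤ n, w i ∈ H} := by
    intro n
    induction n with
    | zero =>
      intro s
      by_cases hs : s ∈ H
      · refine (stayWithin_le_one 0 s).trans (le_of_eq ?_)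
        refine ((mem_ae_iff_prob_eq_one (measurableSet_forall_le_mem H 0)).1 ?_).symm
        filter_upwards [pathMeasure_ae_zero (fun _ => g) s] with w hw i hi
        rw [Nat.le_zero.1 hi, hw]
        exact hs
      · simp [stayWithin_of_notMem hs]
    | succ n ih =>
      intro s
      by_cases hs : s ∈ H
      · rw [chain_apply _ _ (measurableSet_forall_le_mem H _), preimage_pathCons_forall_le_mem hs,
          stayWithin_succ_of_mem hs]
        simpa using lintegral_mono ih
      · simp [stayWithin_of_notMem hs]
  rw [iInter_forall_le_mem, (antitone_forall_le_mem H).measure_iInter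
    (fun n => (measurableSet_forall_le_mem H n).nullMeasurableSet) ⟨0, measure_ne_top _ _⟩]
  exact iInf_mono fun n => key n s

/-- An event whose probability is bounded away from one in all states, and which does not become
less likely with time, has probability zero. -/
lemma chain_eq_zero_of_le {A : Set (ℕ → S)} (hA : MeasurableSet A)
    (hcons : ∀ s w, pathCons s w ∈ A → w ∈ A) {c : ℝ≥0∞} (hc1 : c < 1)
    (hc : ∀ s, chain g s A ≤ c) (s : S) : chain g s A = 0 := by
  -- Since `A` survives deletion of the first state, its conditional probability given any finite
  -- prefix is still at most `c`.
  have key : ∀ n x s, chain g s (A ∩ initialCylinder x n) ≤ c * chain g s (initialCylinder x n) := by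
    intro n
    induction n with
    | zero =>
      intro x s
      rw [pathMeasure_initialCylinder_zero]
      by_cases hx : x 0 = s
      · simpa [hx] using (measure_mono Set.inter_subset_left).trans (hc s)
      · refine le_of_eq_of_le ?_ zero_le
        refine measure_mono_null Set.inter_subset_right ?_
        simp [pathMeasure_initialCylinder_zero, hx]
    | succ n ih =>
      intro x s
      rw [chain_apply _ _ (hA.inter (measurableSet_initialCylinder _ _)),
        chain_apply _ _ (measurableSet_initialCylinder _ _), ← lintegral_const_mul _ .of_discrete]
      refine lintegral_mono fun t => ?_
      by_cases hx : x 0 = s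
      · rw [Set.preimage_inter, preimage_pathCons_initialCylinder_succ hx]
        refine le_trans (measure_mono ?_) (ih _ t)
        exact Set.inter_subset_inter_left _ fun w hw => hcons s w hw
      · simp [preimage_pathCons_initialCylinder_of_ne hx]
  -- Evaluated at `A` itself, this domination gives `P(A) ≤ c * P(A)`: a zero-one law without
  -- martingales.
  have hle : (chain g s).restrict A ≤ c • chain g s := by
    have : IsFiniteMeasure (c • chain g s) :=
      Measure.smul_finite _ (ne_top_of_lt hc1)
    refine measure_le_of_initialCylinder fun x n => ?_
    rw [Measure.restrict_apply (measurableSet_initialCylinder x n), Set.inter_comm]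
    exact key n x s
  have h := hle A
  rw [Measure.restrict_apply hA, Set.inter_self, Measure.smul_apply, smul_eq_mul] at h
  by_contra h0
  have hlt := ENNReal.mul_lt_mul_left h0 (measure_ne_top (chain g s) A) hc1
  rw [one_mul] at hlt
  exact absurd h (not_le.2 hlt)

/-- If a Markov chain visits almost surely the colour `2` or a state from which it stays in the
colour `0` with probability at least one half, then it satisfies the parity objective. -/
lemma chain_parity_eq_one {col : S → ℕ} (hcol : ∀ s, col s ≤ 2)
    (hg : ∀ s, reach (fun t => {g t})
      ({t | col t = 2} ∪ {t | 2⁻¹ ≤ stay (fun r => {g r}) {r | col r = 0} t}) s = 1) (s : S) :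
    chain g s (parity col) = 1 := by
  set T : Set S := {t | col t = 2} ∪ {t | 2⁻¹ ≤ stay (fun r => {g r}) {r | col r = 0} t}
  -- The bad event is to lose without ever seeing colour 2; once all its shifts are null, a losing
  -- play must see colour 2 infinitely often.
  set A : Set (ℕ → S) := {w | (∀ n, w n ∈ {t | col t ≠ 2}) ∧ w ∉ parity col}
  have hA : MeasurableSet A :=
    (measurableSet_forall_mem _).inter (measurableSet_parity col).compl
  have hAcons : ∀ s w, pathCons s w ∈ A → w ∈ A := fun s w hw =>
    ⟨fun n => hw.1 (n + 1), fun h => hw.2 (pathCons_mem_parity.2 h)⟩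
  have hAT : ∀ s ∈ T, chain g s A ≤ 2⁻¹ := by
    rintro s (hs | hs)
    · refine le_of_eq_of_le (measure_eq_zero_iff_ae_notMem.2 ?_) zero_le
      filter_upwards [pathMeasure_ae_zero (fun _ => g) s] with w hw hwA
      exact hwA.1 0 (by rw [hw]; exact hs)
    · have h1 : chain g s {w | ∀ n, w n ∈ {r | col r = 0}}ᶜ ≤ 2⁻¹ := by
        rw [prob_compl_eq_one_sub (measurableSet_forall_mem _), tsub_le_iff_right]
        calc (1 : ℝ≥0∞) = 2⁻¹ + 2⁻¹ := ENNReal.inv_two_add_inv_two.symm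
          _ ≤ _ := by gcongr; exact le_trans hs (stay_le_chain g _ s)
      refine (measure_mono fun w hw h0 => hw.2 ?_).trans h1
      exact ⟨0, Frequently.of_forall fun n => h0 n, Eventually.of_forall fun n => (h0 n).le⟩
  have hAhalf : ∀ s, chain g s A ≤ 2⁻¹ := by
    -- At the first visit to `T` the bad event has probability at most 1/2, so each unit of
    -- probability of reaching `T` costs it at least 1/2.
    have key : ∀ n s, chain g s A + 2⁻¹ * reachWithin (fun t => {g t}) T n s ≤ 1 := by
      have hTle : ∀ n, ∀ s ∈ T, chain g s A + 2⁻¹ * reachWithin (fun t => {g t}) T n s ≤ 1 := by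
        intro n s hs
        rw [reachWithin_of_mem hs, mul_one, ← ENNReal.inv_two_add_inv_two]
        gcongr
        exact hAT s hs
      intro n
      induction n with
      | zero =>
        intro s
        by_cases hs : s ∈ T
        · exact hTle 0 s hs
        · simpa [reachWithin_zero_of_notMem hs] using prob_le_one
      | succ n ih =>
        intro s
        by_cases hs : s ∈ T
        · exact hTle _ s hs
        · rw [reachWithin_succ_of_notMem hs, chain_apply _ _ hA]
          simp only [Set.mem_singleton_iff, iSup_iSup_eq_left]
          rw [← lintegral_const_mul _ .of_discrete, ← lintegral_add_right _ .of_discrete]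
          refine le_trans (lintegral_mono fun t => ?_) (lintegral_pmf_le_of_le ih)
          gcongr
          exact fun w hw => hAcons s w hw
    intro s
    have h : chain g s A + 2⁻¹ ≤ 1 := by
      calc chain g s A + 2⁻¹ = ⨆ n, (chain g s A + 2⁻¹ * reachWithin (fun t => {g t}) T n s) := by
            rw [← ENNReal.add_iSup, ← ENNReal.mul_iSup]
            have := hg s
            rw [reach] at this
            rw [this, mul_one]
        _ ≤ 1 := iSup_le fun n => key n s
    rw [← ENNReal.inv_two_add_inv_two] at h
    exact (ENNReal.add_le_add_iff_right (by simp)).1 h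
  have hA0 : ∀ s, chain g s A = 0 :=
    chain_eq_zero_of_le hA hAcons (by simp) hAhalf
  have hshift : ∀ N s, chain g s {w | (fun n => w (n + N)) ∈ A} = 0 := by
    intro N
    induction N with
    | zero => exact hA0
    | succ N ih =>
      intro s
      have hm : Measurable fun (w : ℕ → S) (n : ℕ) => w (n + (N + 1)) := by fun_prop
      have hm' : MeasurableSet {w : ℕ → S | (fun n => w (n + (N + 1))) ∈ A} := hm hA
      rw [chain_apply _ _ hm']
      simp only [Set.preimage_ofPred_eq, ← add_assoc, pathCons_succ, ih, lintegral_zero]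
  refine (mem_ae_iff_prob_eq_one (measurableSet_parity col)).1 ?_
  have hae : ∀ᵐ w ∂chain g s, ∀ N, w ∉ {w : ℕ → S | (fun n => w (n + N)) ∈ A} :=
    ae_all_iff.2 fun N => measure_eq_zero_iff_ae_notMem.1 (hshift N s)
  filter_upwards [hae] with w hw
  by_contra hpar
  have hpar' : ∀ N, (fun n => w (n + N)) ∉ parity col := by
    intro N h
    induction N with
    | zero => exact hpar h
    | succ N ih =>
      refine ih (Eq.mp (congrArg (· ∈ parity col) ?_) (pathCons_mem_parity (s := w N).2 h))
      ext n
      cases n with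
      | zero => simp
      | succ n => simp [add_assoc, add_comm 1 N]
  have hfreq : ∃ᶠ n in atTop, col (w n) = 2 := by
    rw [frequently_atTop]
    intro N
    have := hw N
    by_contra! hcon
    exact this ⟨fun n => hcon (n + N) (by lia), hpar' N⟩
  exact hpar ⟨1, hfreq, Eventually.of_forall fun n => hcol _⟩

end MDP

/-! ### Optimal strategies and value-preserving decisions. -/

namespace MDP

variable {S : Type*} {M : MDP S}

lemma preimage_pathCons_parity (col : S → ℕ) (s : S) : pathCons s ⁻¹' parity col = parity col := by
  ext w; exact pathCons_mem_parity

namespace Strategy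

/-- The behaviour of a strategy after the first state `s`. -/
def tail (σ : M.Strategy) (s : S) : M.Strategy where
  choice w := σ.choice (s :: w)
  step_of_mem_support w := σ.step_of_mem_support (s :: w)

/-- The memoryless deterministic strategy that chooses the successors given by `f`. -/
noncomputable def ofFun (f : {s : S // s ∈ M.player} → S) (hf : ∀ s : {s : S // s ∈ M.player}, M.step s (f s)) :
    M.Strategy where
  choice _ s := PMF.pure (f s)
  step_of_mem_support _ s t ht := by
    rw [PMF.support_pure, Set.mem_singleton_iff] at ht
    exact ht ▸ hf s

/-- The strategy that makes its first choice according to `τ` and then continues according to `θ t`,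
where `t` is the second state. -/
noncomputable def glue (τ : M.Strategy) (θ : S → M.Strategy) : M.Strategy where
  choice w s := match w with
    | [] => τ.choice [] s
    -- With a one-element history the current state `s` is itself the second state, so it selects
    -- the continuation.
    | [_] => (θ s).choice [] s
    | _ :: t :: w => (θ t).choice (t :: w) s
  step_of_mem_support w s := by
    match w with
    | [] => exact τ.step_of_mem_support [] s
    | [_] => exact (θ s).step_of_mem_support [] s
    | _ :: t :: w => exact (θ t).step_of_mem_support (t :: w) s

lemma next_of_mem (σ : M.Strategy) (w : List S) {s : S} (hs : s ∈ M.player) :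
    σ.next w s = σ.choice w ⟨s, hs⟩ := by simp [next, hs]

lemma next_of_notMem (σ : M.Strategy) (w : List S) {s : S} (hs : s ∉ M.player) :
    σ.next w s = M.prob ⟨s, hs⟩ := by simp [next, hs]

lemma step_of_mem_support_next (σ : M.Strategy) (w : List S) {s t : S}
    (ht : t ∈ (σ.next w s).support) : M.step s t := by
  by_cases hs : s ∈ M.player
  · rw [next_of_mem _ _ hs] at ht; exact σ.step_of_mem_support w _ t ht
  · rw [next_of_notMem _ _ hs] at ht; exact M.step_of_mem_support _ t ht

lemma next_nil_glue (τ : M.Strategy) (θ : S → M.Strategy) (s : S) :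
    (τ.glue θ).next [] s = τ.next [] s := rfl

end Strategy

variable [MeasurableSpace S] [DiscreteMeasurableSpace S] [Countable S]

lemma lintegral_pmf (p : PMF S) (h : S → ℝ≥0∞) : ∫⁻ t, h t ∂p.toMeasure = ∑' t, p t * h t := by
  rw [lintegral_countable']
  refine tsum_congr fun t => ?_
  rw [PMF.toMeasure_apply_singleton _ _ (measurableSet_singleton t), mul_comm]

lemma lintegral_pmf_pure (t : S) (h : S → ℝ≥0∞) : ∫⁻ r, h r ∂(PMF.pure t).toMeasure = h t := by
  rw [PMF.toMeasure_pure, lintegral_dirac]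

lemma ae_pmf_iff {p : PMF S} {P : S → Prop} :
    (∀ᵐ t ∂p.toMeasure, P t) ↔ ∀ t ∈ p.support, P t := by
  rw [ae_iff_of_countable]
  simp only [PMF.toMeasure_apply_singleton _ _ (measurableSet_singleton _), PMF.mem_support_iff]

lemma lintegral_pmf_mono {p : PMF S} {h k : S → ℝ≥0∞} (hk : ∀ t ∈ p.support, h t ≤ k t) :
    ∫⁻ t, h t ∂p.toMeasure ≤ ∫⁻ t, k t ∂p.toMeasure :=
  lintegral_mono_ae (ae_pmf_iff.2 hk)

/-- Only the start state can occur with empty history, so agreement is needed there alone;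
continuations of a glued strategy agree with `θ t` only in this sense. -/
lemma pathMeasure_congr {N N' : List S → S → PMF S} {s : S} (h0 : N [] s = N' [] s)
    (h : ∀ w t, N (s :: w) t = N' (s :: w) t) : pathMeasure N s = pathMeasure N' s := by
  ext A hA
  rw [pathMeasure_apply _ _ hA, pathMeasure_apply _ _ hA, h0]
  have : (fun w => N (s :: w)) = fun w => N' (s :: w) := by
    ext1 w; ext1 t; exact h w t
  rw [this]


namespace Strategy

lemma playMeasure_apply (σ : M.Strategy) (s : S) {A : Set (ℕ → S)} (hA : MeasurableSet A) :
    σ.playMeasure s A =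
      ∫⁻ t, (σ.tail s).playMeasure t (pathCons s ⁻¹' A) ∂(σ.next [] s).toMeasure :=
  pathMeasure_apply σ.next s hA

instance (σ : M.Strategy) (s : S) : IsProbabilityMeasure (σ.playMeasure s) :=
  inferInstanceAs (IsProbabilityMeasure (pathMeasure σ.next s))

lemma playMeasure_tail_glue (τ : M.Strategy) (θ : S → M.Strategy) (s t : S) :
    ((τ.glue θ).tail s).playMeasure t = (θ t).playMeasure t :=
  pathMeasure_congr rfl fun _ _ => rfl

end Strategy

open Strategy

variable {col : S → ℕ} {s t : S}

lemma playMeasure_parity_le_value (σ : M.Strategy) (s : S) :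
    σ.playMeasure s (parity col) ≤ M.value (parity col) s :=
  le_iSup (fun σ : M.Strategy => σ.playMeasure s (parity col)) σ

lemma value_le_one (s : S) : M.value (parity col) s ≤ 1 := iSup_le fun _ => prob_le_one

lemma value_ne_top (s : S) : M.value (parity col) s ≠ ∞ :=
  ne_top_of_le_ne_top ENNReal.one_ne_top (value_le_one s)

/-- Follow the first step of `τ` and then an `ε`-optimal strategy from wherever it leads. -/
lemma lintegral_value_le (τ : M.Strategy) (s : S) :
    ∫⁻ t, M.value (parity col) t ∂(τ.next [] s).toMeasure ≤ M.value (parity col) s := by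
  refine ENNReal.le_of_forall_pos_le_add fun ε hε _ => ?_
  have hε' : (ε : ℝ≥0∞) ≠ 0 := by simpa using hε.ne'
  have hθ : ∀ t, ∃ θ : M.Strategy,
      M.value (parity col) t ≤ θ.playMeasure t (parity col) + ε := by
    intro t
    by_cases h0 : M.value (parity col) t = 0
    · exact ⟨τ, by simp [h0]⟩
    · obtain ⟨θ, hθ⟩ := lt_iSup_iff.1 (ENNReal.sub_lt_self (value_ne_top t) h0 hε')
      exact ⟨θ, tsub_le_iff_right.1 hθ.le⟩
  choose θ hθ using hθ
  have := PMF.toMeasure.isProbabilityMeasure (τ.next [] s)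
  calc ∫⁻ t, M.value (parity col) t ∂(τ.next [] s).toMeasure
      ≤ ∫⁻ t, ((θ t).playMeasure t (parity col) + ε) ∂(τ.next [] s).toMeasure := lintegral_mono hθ
    _ = ∫⁻ t, (θ t).playMeasure t (parity col) ∂(τ.next [] s).toMeasure + ε := by
        rw [lintegral_add_right _ .of_discrete]; simp
    _ = (τ.glue θ).playMeasure s (parity col) + ε := by
        rw [playMeasure_apply _ _ (measurableSet_parity col), next_nil_glue,
          preimage_pathCons_parity]
        simp only [playMeasure_tail_glue]
    _ ≤ M.value (parity col) s + ε := by gcongr; exact playMeasure_parity_le_value _ s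

lemma value_le_of_step (hs : s ∈ M.player) (hst : M.step s t) :
    M.value (parity col) t ≤ M.value (parity col) s := by
  classical
  choose f hf using M.exists_step
  let τ : M.Strategy := ofFun (fun r => if r.1 = s then t else f r) fun r => by
    by_cases hr : r.1 = s
    · simpa [hr] using hst
    · simpa [hr] using hf r
  have h := lintegral_value_le (col := col) τ s
  have hτ : τ.next [] s = PMF.pure t := by
    rw [next_of_mem _ _ hs]
    simp [τ, ofFun]
  rwa [hτ, lintegral_pmf_pure] at h

namespace Strategy.IsOptimalFrom

variable {τ : M.Strategy}

/-- Optimality closes the chain: averaged value of the successors ≤ value of `s` ≤ winning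
probability of `τ` = averaged winning probability of its tail. -/
lemma lintegral_tail_eq (hτ : τ.IsOptimalFrom (parity col) s) :
    ∫⁻ t, (τ.tail s).playMeasure t (parity col) ∂(τ.next [] s).toMeasure =
      ∫⁻ t, M.value (parity col) t ∂(τ.next [] s).toMeasure := by
  refine le_antisymm (lintegral_mono fun t => playMeasure_parity_le_value _ t) ?_
  refine (lintegral_value_le τ s).trans (le_trans hτ ?_)
  rw [playMeasure_apply _ _ (measurableSet_parity col), preimage_pathCons_parity]

lemma lintegral_value (hτ : τ.IsOptimalFrom (parity col) s) :
    ∫⁻ t, M.value (parity col) t ∂(τ.next [] s).toMeasure = M.value (parity col) s := by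
  refine le_antisymm (lintegral_value_le τ s) ?_
  rw [← hτ.lintegral_tail_eq]
  refine le_trans hτ ?_
  rw [playMeasure_apply _ _ (measurableSet_parity col), preimage_pathCons_parity]

/-- The tail never beats the value, and both have the same finite average, so they agree at every
successor taken. -/
lemma tail (hτ : τ.IsOptimalFrom (parity col) s)
    (ht : t ∈ (τ.next [] s).support) : (τ.tail s).IsOptimalFrom (parity col) t := by
  have h := ae_eq_of_ae_le_of_lintegral_le (μ := (τ.next [] s).toMeasure)
    (f := fun t => (τ.tail s).playMeasure t (parity col)) (g := M.value (parity col))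
    (Eventually.of_forall fun t => playMeasure_parity_le_value _ t)
    (by rw [hτ.lintegral_tail_eq, hτ.lintegral_value]; exact value_ne_top s)
    Measurable.of_discrete.aemeasurable hτ.lintegral_tail_eq.ge
  exact (ae_pmf_iff.1 h t ht).ge

/-- No successor of a player state exceeds its value, yet the average attains it. -/
lemma value_eq (hτ : τ.IsOptimalFrom (parity col) s) (hs : s ∈ M.player)
    (ht : t ∈ (τ.next [] s).support) : M.value (parity col) t = M.value (parity col) s := by
  have := PMF.toMeasure.isProbabilityMeasure (τ.next [] s)
  have h := ae_eq_of_ae_le_of_lintegral_le (μ := (τ.next [] s).toMeasure)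
    (f := M.value (parity col)) (g := fun _ => M.value (parity col) s)
    (ae_pmf_iff.2 fun t ht => value_le_of_step hs (τ.step_of_mem_support_next [] ht))
    (by rw [hτ.lintegral_value]; exact value_ne_top s)
    Measurable.of_discrete.aemeasurable (by simp [hτ.lintegral_value])
  exact ae_pmf_iff.1 h t ht

end Strategy.IsOptimalFrom

/-- The states with positive value from which some strategy is optimal. -/
def optimalStates (M : MDP S) (col : S → ℕ) : Set S :=
  {s | M.value (parity col) s ≠ 0 ∧ ∃ τ : M.Strategy, τ.IsOptimalFrom (parity col) s}

open Classical in
/-- The decisions that are available if one is to keep the value: in player states the successors of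
the same value that have an optimal strategy; in random states the distribution in which
each successor is weighted by its value. -/
def optimalDecisions (M : MDP S) (col : S → ℕ) (s : S) : Set (PMF S) :=
  if s ∈ M.optimalStates col then
    if h : s ∈ M.player then
      PMF.pure '' {t | M.step s t ∧ t ∈ M.optimalStates col ∧
        M.value (parity col) t = M.value (parity col) s}
    else {q | ∀ t, M.value (parity col) s * q t = M.prob ⟨s, h⟩ t * M.value (parity col) t}
  else {PMF.pure s}

lemma optimalDecisions_of_notMem (hs : s ∉ M.optimalStates col) :
    M.optimalDecisions col s = {PMF.pure s} := by simp [optimalDecisions, hs]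

lemma optimalDecisions_of_mem_player (hs : s ∈ M.optimalStates col) (h : s ∈ M.player) :
    M.optimalDecisions col s = PMF.pure '' {t | M.step s t ∧ t ∈ M.optimalStates col ∧
      M.value (parity col) t = M.value (parity col) s} := by
  simp [optimalDecisions, hs, h]

lemma optimalDecisions_of_notMem_player (hs : s ∈ M.optimalStates col) (h : s ∉ M.player) :
    M.optimalDecisions col s =
      {q | ∀ t, M.value (parity col) s * q t = M.prob ⟨s, h⟩ t * M.value (parity col) t} := by
  simp [optimalDecisions, hs, h]

lemma Strategy.IsOptimalFrom.mem_optimalStates {τ : M.Strategy}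
    (hτ : τ.IsOptimalFrom (parity col) s) (ht : t ∈ (τ.next [] s).support)
    (h0 : M.value (parity col) t ≠ 0) : t ∈ M.optimalStates col :=
  ⟨h0, _, hτ.tail ht⟩

lemma finite_optimalDecisions (hM : M.FinitelyBranching) (s : S) :
    (M.optimalDecisions col s).Finite := by
  by_cases hs : s ∈ M.optimalStates col
  · by_cases h : s ∈ M.player
    · rw [optimalDecisions_of_mem_player hs h]
      exact ((hM s).subset fun t ht => ht.1).image _
    · rw [optimalDecisions_of_notMem_player hs h]
      refine Set.Subsingleton.finite fun p hp q hq => ?_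
      ext t
      exact (ENNReal.mul_right_inj hs.1 (value_ne_top s)).1 ((hp t).trans (hq t).symm)
  · rw [optimalDecisions_of_notMem hs]
    exact Set.finite_singleton _

lemma nonempty_optimalDecisions (s : S) : (M.optimalDecisions col s).Nonempty := by
  by_cases hs : s ∈ M.optimalStates col
  · obtain ⟨h0, τ, hτ⟩ := id hs
    by_cases h : s ∈ M.player
    · rw [optimalDecisions_of_mem_player hs h]
      obtain ⟨t, ht⟩ := (τ.next [] s).support_nonempty
      have hv := hτ.value_eq h ht
      exact ⟨_, t, ⟨τ.step_of_mem_support_next [] ht,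
        hτ.mem_optimalStates ht (by rw [hv]; exact h0), hv⟩, rfl⟩
    · rw [optimalDecisions_of_notMem_player hs h]
      -- The reweighted distribution has total mass one precisely because an optimal step preserves
      -- the value on average.
      have hv := hτ.lintegral_value
      rw [next_of_notMem _ _ h, lintegral_pmf] at hv
      refine ⟨⟨fun t => (M.value (parity col) s)⁻¹ *
        (M.prob ⟨s, h⟩ t * M.value (parity col) t), ?_⟩, fun t => ?_⟩
      · rw [ENNReal.summable.hasSum_iff, ENNReal.tsum_mul_left, hv]
        exact ENNReal.inv_mul_cancel h0 (value_ne_top s)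
      · exact ENNReal.mul_inv_cancel_left h0 (value_ne_top s)
  · rw [optimalDecisions_of_notMem hs]
    exact Set.singleton_nonempty _

/-- At random states, successors of value zero receive weight zero; the others inherit an optimal
strategy as a tail. -/
lemma mem_optimalStates_of_mem_support {p : PMF S} (hs : s ∈ M.optimalStates col)
    (hp : p ∈ M.optimalDecisions col s) (ht : t ∈ p.support) : t ∈ M.optimalStates col := by
  obtain ⟨h0, τ, hτ⟩ := id hs
  by_cases h : s ∈ M.player
  · rw [optimalDecisions_of_mem_player hs h] at hp
    obtain ⟨r, hr, rfl⟩ := hp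
    rw [PMF.support_pure, Set.mem_singleton_iff] at ht
    exact ht ▸ hr.2.1
  · rw [optimalDecisions_of_notMem_player hs h] at hp
    have hne : M.prob ⟨s, h⟩ t * M.value (parity col) t ≠ 0 := by
      rw [← hp t]
      exact mul_ne_zero h0 ht
    refine hτ.mem_optimalStates ?_ (right_ne_zero_of_mul hne)
    rw [next_of_notMem _ _ h]
    exact left_ne_zero_of_mul hne

/-- A step of an optimal strategy, weighted by the value, is dominated by the decisions that
keep the value. -/
lemma lintegral_value_mul_le {τ : M.Strategy} (hs : s ∈ M.optimalStates col)
    (hτ : τ.IsOptimalFrom (parity col) s) (h : S → ℝ≥0∞) :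
    ∫⁻ t, M.value (parity col) t * h t ∂(τ.next [] s).toMeasure ≤
      M.value (parity col) s * ⨆ p ∈ M.optimalDecisions col s, ∫⁻ t, h t ∂p.toMeasure := by
  by_cases hp : s ∈ M.player
  · have := PMF.toMeasure.isProbabilityMeasure (τ.next [] s)
    refine (lintegral_pmf_mono (k := fun _ => M.value (parity col) s *
      ⨆ p ∈ M.optimalDecisions col s, ∫⁻ t, h t ∂p.toMeasure) fun t ht => ?_).trans (by simp)
    have hv := hτ.value_eq hp ht
    rw [hv]
    gcongr
    refine le_iSup₂_of_le (PMF.pure t) ?_ (lintegral_pmf_pure t h).ge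
    rw [optimalDecisions_of_mem_player hs hp]
    exact ⟨t, ⟨τ.step_of_mem_support_next [] ht,
      hτ.mem_optimalStates ht (by rw [hv]; exact hs.1), hv⟩, rfl⟩
  · obtain ⟨q, hq⟩ := nonempty_optimalDecisions (M := M) (col := col) s
    refine le_trans ?_ (mul_le_mul_right (le_iSup₂_of_le q hq le_rfl) _)
    rw [optimalDecisions_of_notMem_player hs hp] at hq
    rw [next_of_notMem _ _ hp, lintegral_pmf, lintegral_pmf, ← ENNReal.tsum_mul_left]
    refine ENNReal.tsum_le_tsum fun t => ?_
    rw [← mul_assoc, ← hq t, mul_assoc]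

end MDP

/-! ### From optimal strategies to reachability under value-preserving decisions. -/

namespace MDP

variable {S : Type*} [MeasurableSpace S] [DiscreteMeasurableSpace S] [Countable S]
  {M : MDP S} {col : S → ℕ} {s t : S}

/-- Among the sequences that satisfy the parity objective, an optimal strategy stays in `H` for `n`
steps no more likely than the decisions that keep the value allow. -/
lemma playMeasure_parity_inter_stay_le (H : Set S) (n : ℕ) : ∀ (s : S) (τ : M.Strategy),
    τ.IsOptimalFrom (parity col) s →
    τ.playMeasure s (parity col ∩ {w | ∀ i ≤ n, w i ∈ H}) ≤
      M.value (parity col) s * stayWithin (M.optimalDecisions col) H n s := by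
  induction n with
  | zero =>
    intro s τ _
    by_cases hs : s ∈ H
    · rw [stayWithin_zero_of_mem hs, mul_one]
      exact (measure_mono Set.inter_subset_left).trans (playMeasure_parity_le_value τ s)
    · refine le_of_eq_of_le (measure_mono_null Set.inter_subset_right ?_) zero_le
      refine measure_eq_zero_iff_ae_notMem.2 ?_
      filter_upwards [pathMeasure_ae_zero τ.next s] with w hw hwH
      exact hs (hw ▸ hwH 0 le_rfl)
  | succ n ih =>
    intro s τ hτ
    by_cases h0 : M.value (parity col) s = 0
    · rw [h0, zero_mul, ← h0]
      exact (measure_mono Set.inter_subset_left).trans (playMeasure_parity_le_value τ s)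
    by_cases hs : s ∈ H
    · rw [Strategy.playMeasure_apply _ _ ((measurableSet_parity col).inter (measurableSet_forall_le_mem H _)),
        Set.preimage_inter, preimage_pathCons_parity, preimage_pathCons_forall_le_mem hs,
        stayWithin_succ_of_mem hs]
      -- The induction runs over all optimal strategies at once, since the tail of one is again
      -- optimal.
      exact (lintegral_pmf_mono fun t ht => ih t _ (hτ.tail ht)).trans
        (lintegral_value_mul_le ⟨h0, τ, hτ⟩ hτ _)
    · refine le_of_eq_of_le (measure_mono_null Set.inter_subset_right ?_) zero_le
      refine measure_eq_zero_iff_ae_notMem.2 ?_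
      filter_upwards [pathMeasure_ae_zero τ.next s] with w hw hwH
      exact hs (hw ▸ hwH 0 (Nat.zero_le _))

/-- Among the sequences that satisfy the parity objective, an optimal strategy visits `T` within `n`
steps no more likely than the decisions that keep the value allow. -/
lemma playMeasure_parity_inter_reach_le (T : Set S) (n : ℕ) : ∀ (s : S) (τ : M.Strategy),
    τ.IsOptimalFrom (parity col) s →
    τ.playMeasure s (parity col ∩ {w | ∀ i ≤ n, w i ∈ Tᶜ}ᶜ) ≤
      M.value (parity col) s * reachWithin (M.optimalDecisions col) T n s := by
  induction n with
  | zero =>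
    intro s τ _
    by_cases hs : s ∈ T
    · rw [reachWithin_of_mem hs, mul_one]
      exact (measure_mono Set.inter_subset_left).trans (playMeasure_parity_le_value τ s)
    · refine le_of_eq_of_le (measure_mono_null Set.inter_subset_right ?_) zero_le
      refine measure_eq_zero_iff_ae_notMem.2 ?_
      filter_upwards [pathMeasure_ae_zero τ.next s] with w hw hwT
      refine hwT fun i hi => ?_
      rw [Nat.le_zero.1 hi, hw]
      exact hs
  | succ n ih =>
    intro s τ hτ
    by_cases h0 : M.value (parity col) s = 0
    · rw [h0, zero_mul, ← h0]
      exact (measure_mono Set.inter_subset_left).trans (playMeasure_parity_le_value τ s)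
    by_cases hs : s ∈ T
    · rw [reachWithin_of_mem hs, mul_one]
      exact (measure_mono Set.inter_subset_left).trans (playMeasure_parity_le_value τ s)
    · rw [Strategy.playMeasure_apply _ _
          ((measurableSet_parity col).inter (measurableSet_forall_le_mem _ _).compl),
        Set.preimage_inter, preimage_pathCons_parity, Set.preimage_compl,
        preimage_pathCons_forall_le_mem (H := Tᶜ) hs, reachWithin_succ_of_notMem hs]
      exact (lintegral_pmf_mono fun t ht => ih t _ (hτ.tail ht)).trans
        (lintegral_value_mul_le ⟨h0, τ, hτ⟩ hτ _)

/-- If the decisions that keep the value do not allow one to stay in `H`, then under an optimal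
strategy the sequences that satisfy the parity objective do not eventually stay in `H`. -/
lemma playMeasure_parity_inter_eventually_eq_zero {H : Set S}
    (hH : ∀ s, stay (M.optimalDecisions col) H s = 0) (N : ℕ) : ∀ (s : S) (τ : M.Strategy),
    τ.IsOptimalFrom (parity col) s →
    τ.playMeasure s (parity col ∩ {w | ∀ n, w (n + N) ∈ H}) = 0 := by
  induction N with
  | zero =>
    intro s τ hτ
    refine le_antisymm ?_ zero_le
    have h : M.value (parity col) s * stay (M.optimalDecisions col) H s = 0 := by simp [hH]
    rw [← h, stay, ENNReal.mul_iInf fun h => absurd h (value_ne_top s)]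
    refine le_iInf fun n => le_trans (measure_mono ?_) (playMeasure_parity_inter_stay_le H n s τ hτ)
    exact Set.inter_subset_inter_right _ fun w hw i _ => hw i
  | succ N ih =>
    intro s τ hτ
    have hm : MeasurableSet {w : ℕ → S | ∀ n, w (n + (N + 1)) ∈ H} := by
      have : {w : ℕ → S | ∀ n, w (n + (N + 1)) ∈ H} = ⋂ n, (fun w => w (n + (N + 1))) ⁻¹' H := by
        ext; simp
      rw [this]
      exact .iInter fun n => measurable_pi_apply _ .of_discrete
    rw [Strategy.playMeasure_apply _ _ ((measurableSet_parity col).inter hm)]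
    refine le_antisymm ?_ zero_le
    refine (lintegral_pmf_mono (k := fun _ => 0) fun t ht => ?_).trans (by simp)
    rw [Set.preimage_inter, preimage_pathCons_parity]
    exact (ih t _ (hτ.tail ht)).le

open Classical in
/-- The colour function that recolours by `0` the states outside of `optimalStates`. -/
noncomputable def recolour (M : MDP S) (col : S → ℕ) (s : S) : ℕ :=
  if s ∈ M.optimalStates col then col s else 0

lemma recolour_of_mem (hs : s ∈ M.optimalStates col) : M.recolour col s = col s := by
  simp [recolour, hs]

lemma recolour_of_notMem (hs : s ∉ M.optimalStates col) : M.recolour col s = 0 := by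
  simp [recolour, hs]

/-- With the decisions that keep the value, each set that contains the colour `2` and that cannot be
avoided within the colour `0` can be reached with probability arbitrarily close to one. -/
lemma reach_optimalDecisions_eq_one (hcol : ∀ s, col s ≤ 2) {T : Set S}
    (hT : ∀ s, M.recolour col s = 2 → s ∈ T)
    (hstay : ∀ s, stay (M.optimalDecisions col) ({t | M.recolour col t = 0} \ T) s = 0) (s : S) :
    reach (M.optimalDecisions col) T s = 1 := by
  -- Such states are absorbing with new colour 0, so outside `T` one could stay there forever.
  have hout : ∀ s ∉ M.optimalStates col, s ∈ T := by
    intro s hs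
    by_contra hsT
    have hsH : s ∈ {t | M.recolour col t = 0} \ T := ⟨recolour_of_notMem hs, hsT⟩
    have key : ∀ n, stayWithin (M.optimalDecisions col) ({t | M.recolour col t = 0} \ T) n s = 1 := by
      intro n
      induction n with
      | zero => exact stayWithin_zero_of_mem hsH
      | succ n ih =>
        rw [stayWithin_succ_of_mem hsH, optimalDecisions_of_notMem hs]
        simp only [Set.mem_singleton_iff, iSup_iSup_eq_left]
        rw [lintegral_pmf_pure, ih]
    have h := hstay s
    simp [stay, key] at h
  by_cases hs : s ∈ M.optimalStates col
  swap
  · exact reach_of_mem (hout s hs)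
  obtain ⟨h0, τ, hτ⟩ := id hs
  -- A winning play that avoids `T` has no colour 2, so its dominating even colour is 0 and it is
  -- eventually confined to colour 0.
  have hnever : τ.playMeasure s (parity col ∩ {w | ∀ n, w n ∈ Tᶜ}) = 0 := by
    refine measure_mono_null ?_ (measure_iUnion_null fun N =>
      playMeasure_parity_inter_eventually_eq_zero hstay N s τ hτ)
    rintro w ⟨hw, hwT⟩
    have hwO : ∀ n, w n ∈ M.optimalStates col := fun n => by
      by_contra h
      exact hwT n (hout _ h)
    have hw2 : ∀ n, col (w n) ≠ 2 := fun n h =>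
      hwT n (hT _ (by rw [recolour_of_mem (hwO n), h]))
    obtain ⟨i, hfreq, hev⟩ := id hw
    obtain ⟨n, hn⟩ := hfreq.exists
    have hi : i = 0 := by
      have h1 := hcol (w n)
      have h2 := hw2 n
      lia
    obtain ⟨N, hN⟩ := eventually_atTop.1 hev
    refine Set.mem_iUnion.2 ⟨N, hw, fun m => ⟨?_, hwT _⟩⟩
    have := hN (m + N) (by lia)
    change M.recolour col (w (m + N)) = 0
    rw [recolour_of_mem (hwO _)]
    lia
  have hle : M.value (parity col) s ≤
      M.value (parity col) s * reach (M.optimalDecisions col) T s := by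
    have hunion : parity col ⊆ (parity col ∩ {w | ∀ n, w n ∈ Tᶜ}) ∪
        ⋃ n, (parity col ∩ {w | ∀ i ≤ n, w i ∈ Tᶜ}ᶜ) := by
      intro w hw
      by_cases h : ∀ n, w n ∈ Tᶜ
      · exact Or.inl ⟨hw, h⟩
      · push Not at h
        obtain ⟨n, hn⟩ := h
        exact Or.inr (Set.mem_iUnion.2 ⟨n, hw, fun h' => hn (h' n le_rfl)⟩)
    have hmono : Monotone fun n => parity col ∩ {w | ∀ i ≤ n, w i ∈ Tᶜ}ᶜ := fun m n hmn =>
      Set.inter_subset_inter_right _ (Set.compl_subset_compl.2 (antitone_forall_le_mem Tᶜ hmn))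
    calc M.value (parity col) s ≤ τ.playMeasure s (parity col) := hτ
      _ ≤ _ := measure_mono hunion
      _ ≤ _ := measure_union_le _ _
      _ = ⨆ n, τ.playMeasure s (parity col ∩ {w | ∀ i ≤ n, w i ∈ Tᶜ}ᶜ) := by
          rw [hnever, zero_add, hmono.measure_iUnion]
      _ ≤ ⨆ n, M.value (parity col) s * reachWithin (M.optimalDecisions col) T n s :=
          iSup_mono fun n => playMeasure_parity_inter_reach_le T n s τ hτ
      _ = _ := by rw [reach, ENNReal.mul_iSup]
  refine le_antisymm (reach_le_one s) ?_
  by_contra! hlt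
  have := ENNReal.mul_lt_mul_right h0 (value_ne_top s) hlt
  rw [mul_one] at this
  exact absurd hle (not_le.2 this)

/-! ### Undoing the weighting, and the final strategy. -/

/-- A Markov chain whose transition probabilities are those of another one weighted by `v` is
dominated in law by that other one, up to the factor `v`. -/
lemma mul_chain_le {g k : S → PMF S} {v : S → ℝ≥0∞} (hv : ∀ s, v s ≤ 1) {O : Set S}
    (hO : ∀ s ∈ O, ∀ t ∈ (g s).support, t ∈ O) (h : ∀ s ∈ O, ∀ t, v s * g s t = k s t * v t)
    (hs : s ∈ O) (A : Set (ℕ → S)) : v s * chain g s A ≤ chain k s A := by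
  -- Along a path the weights telescope, leaving only the value of the last state, which is at most
  -- one.
  have key : ∀ n x, ∀ s ∈ O,
      v s * chain g s (initialCylinder x n) ≤ chain k s (initialCylinder x n) := by
    intro n
    induction n with
    | zero =>
      intro x s _
      rw [pathMeasure_initialCylinder_zero, pathMeasure_initialCylinder_zero]
      calc v s * Set.indicator {s} 1 (x 0) ≤ 1 * Set.indicator {s} 1 (x 0) := by gcongr; exact hv s
        _ = _ := one_mul _
    | succ n ih =>
      intro x s hs
      rw [chain_apply _ _ (measurableSet_initialCylinder _ _),
        chain_apply _ _ (measurableSet_initialCylinder _ _)]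
      by_cases hx : x 0 = s
      · rw [preimage_pathCons_initialCylinder_succ hx, lintegral_pmf, lintegral_pmf,
          ← ENNReal.tsum_mul_left]
        refine ENNReal.tsum_le_tsum fun t => ?_
        rw [← mul_assoc, h s hs t, mul_assoc]
        by_cases ht : t ∈ (g s).support
        · gcongr
          exact ih _ t (hO s hs t ht)
        · have h0 : k s t * v t = 0 := by
            rw [← h s hs t, (g s).apply_eq_zero_iff t |>.2 ht, mul_zero]
          rw [← mul_assoc, h0, zero_mul]
          exact zero_le
      · simp [preimage_pathCons_initialCylinder_of_ne hx]
  have : IsFiniteMeasure (v s • chain g s) :=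
    Measure.smul_finite _ (ne_top_of_le_ne_top ENNReal.one_ne_top (hv s))
  have hle : v s • chain g s ≤ chain k s := measure_le_of_initialCylinder fun x n => key n x s hs
  exact hle A

end MDP

theorem mainTheorem1 {S : Type*} [Countable S] [MeasurableSpace S] [DiscreteMeasurableSpace S]
    (M : MDP S) (hM : M.FinitelyBranching) (col : S → ℕ) (hcol : ∀ s, col s ∈ ({0, 1, 2} : Set ℕ)) :
    ∃ σ : M.Strategy, σ.IsMD ∧
      ∀ s : S, (∃ τ : M.Strategy, τ.IsOptimalFrom (MDP.parity col) s) →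
        σ.IsOptimalFrom (MDP.parity col) s := by
  classical
  have hcol2 : ∀ s, col s ≤ 2 := fun s => by
    rcases hcol s with h | h | h <;> simp_all
  have hrecol : ∀ s, M.recolour col s ≤ 2 := fun s => by
    by_cases hs : s ∈ M.optimalStates col
    · rw [MDP.recolour_of_mem hs]; exact hcol2 s
    · simp [MDP.recolour_of_notMem hs]
  obtain ⟨g, hg, hreach⟩ := MDP.exists_reach_two_or_stay_zero
    (MDP.finite_optimalDecisions (M := M) (col := col) hM)
    MDP.nonempty_optimalDecisions (M.recolour col) fun T hT hstay =>
      MDP.reach_optimalDecisions_eq_one hcol2 hT hstay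
  have hparity := MDP.chain_parity_eq_one hrecol hreach
  have hf : ∀ s : {s : S // s ∈ M.player}, ∃ t, M.step s t ∧
      (s.1 ∈ M.optimalStates col → g s = PMF.pure t ∧
        M.value (MDP.parity col) t = M.value (MDP.parity col) s) := by
    intro s
    by_cases hs : s.1 ∈ M.optimalStates col
    · have h := hg s.1
      rw [MDP.optimalDecisions_of_mem_player hs s.2] at h
      obtain ⟨t, ht, hgt⟩ := h
      exact ⟨t, ht.1, fun _ => ⟨hgt.symm, ht.2.2⟩⟩
    · obtain ⟨t, ht⟩ := M.exists_step s
      exact ⟨t, ht, fun h => absurd h hs⟩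
  choose f hfstep hf using hf
  refine ⟨MDP.Strategy.ofFun f hfstep, ⟨f, fun _ _ => rfl⟩, ?_⟩
  rintro s ⟨τ, hτ⟩
  by_cases h0 : M.value (MDP.parity col) s = 0
  · unfold MDP.Strategy.IsOptimalFrom
    rw [h0]
    exact zero_le
  have hs : s ∈ M.optimalStates col := ⟨h0, τ, hτ⟩
  have hO : ∀ s ∈ M.optimalStates col, ∀ t ∈ (g s).support, t ∈ M.optimalStates col :=
    fun s hs t ht => MDP.mem_optimalStates_of_mem_support hs (hg s) ht
  have hweight : ∀ s ∈ M.optimalStates col, ∀ t, M.value (MDP.parity col) s * g s t =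
      (MDP.Strategy.ofFun f hfstep).next [] s t * M.value (MDP.parity col) t := by
    intro s hs t
    by_cases hp : s ∈ M.player
    · obtain ⟨h1, h2⟩ := hf ⟨s, hp⟩ hs
      rw [MDP.Strategy.next_of_mem _ _ hp]
      change _ = PMF.pure (f ⟨s, hp⟩) t * _
      rw [h1, PMF.pure_apply]
      by_cases ht : t = f ⟨s, hp⟩
      · rw [← ht] at h2
        simp [ht, ← h2]
      · simp [ht]
    · have h := hg s
      rw [MDP.optimalDecisions_of_notMem_player hs hp] at h
      rw [MDP.Strategy.next_of_notMem _ _ hp]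
      exact h t
  have hstay : MDP.chain g s {w | ∀ n, w n ∈ M.optimalStates col} = 1 := by
    refine le_antisymm prob_le_one (le_trans ?_ (MDP.stay_le_chain g _ s))
    have h := MDP.le_mul_stay (D := fun t => {g t}) (H := M.optimalStates col)
      (h := (M.optimalStates col).indicator 1) (c := 1) ENNReal.one_ne_top
      (fun t ht => by simp [ht]) (fun t ht => by simp [ht]) (fun t ht => ?_) s
    · simpa [hs] using h
    · refine ⟨g t, rfl, ?_⟩
      have := PMF.toMeasure.isProbabilityMeasure (g t)
      calc _ = ∫⁻ _, 1 ∂(g t).toMeasure := by simp [ht]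
        _ ≤ _ := MDP.lintegral_pmf_mono fun r hr => by simp [hO t ht r hr]
  have hchain : MDP.chain g s (MDP.parity col) = 1 := by
    refine (mem_ae_iff_prob_eq_one (MDP.measurableSet_parity col)).1 ?_
    filter_upwards [(mem_ae_iff_prob_eq_one (MDP.measurableSet_parity _)).2 (hparity s),
      (mem_ae_iff_prob_eq_one (MDP.measurableSet_forall_mem _)).2 hstay] with w hw hwO
    have : ∀ n, M.recolour col (w n) = col (w n) := fun n => MDP.recolour_of_mem (hwO n)
    simpa only [MDP.parity, Set.mem_ofPred_eq, this] using hw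
  -- The play measure of the memoryless strategy unfolds to the chain with transitions `next []`, so
  -- the weighted bound is exactly optimality.
  have h := MDP.mul_chain_le MDP.value_le_one hO hweight hs (MDP.parity col)
  rwa [hchain, mul_one] at h
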